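/- Let $R_m, S, \lambda > 0$ be fixed and let $\Omega=\mathbb{R}^2$. For $R_e>0$ consider the two-dimensional MHD system in flux-function form $$u_t+(u\cdot\nabla)u+\nabla p=\tfrac1{R_e}\Delta u-S\,\nabla\cdot(\nabla\phi\otimes\nabla\phi),\qquad \nabla\cdot u=0,\qquad \phi_t+(u\cdot\nabla)\phi=\tfrac1{R_m}\Delta\phi,$$ and its inviscid counterpart $$v_t+(v\cdot\nabla)v+\nabla P=-S\,\nabla\cdot(\nabla\psi\otimes\nabla\psi),\qquad \nabla\cdot v=0,\qquad \psi_t+(v\cdot\nabla)\psi=\tfrac1{R_m}\Delta\psi,$$ where $(\nabla\phi\otimes\nabla\phi)_{ij}=\partial_i\phi\,\partial_j\phi$. Solutions are taken as absolutely continuous curves in $L^2(\mathbb{R}^2)$, with weak spatial derivatives; the equations hold at almost every time and almost everywhere in space. A global strong solution of the viscous system is a solution $(u,\phi)$ with $u\in L^\infty(0,T;H^1)\cap L^2(0,T;H^2)$ and $\phi\in L^\infty(0,T;H^2)\cap L^2(0,T;H^3)$ for every $T>0$. A local smooth solution of the inviscid system on $[0,T_*]$, $T_*>0$, is a solution $(v,\psi)$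 with $v\in L^\infty(0,T_*;H^s)$ and $\psi\in L^\infty(0,T_*;H^{s+1})$ for some integer $s\ge3$. Let $(v,\psi)$ be a local smooth solution of the inviscid system on $\mathbb{R}^2\times[0,T_*]$ with initial data $(u_0,\phi_0)$. Then there is a constant $C$, independent of $R_e$, such that for every $R_e>0$, every global strong solution $(u,\phi)$ of the viscous system with the same initial data $(u_0,\phi_0)$, and every $t\in[0,T_*]$, one has $\phi(t)-\psi(t)\in H^1(\mathbb{R}^2)$ and $$\|u(t)-v(t)\|_{L^2}^2+\lambda\|\phi(t)-\psi(t)\|_{H^1}^2\le C\,R_e^{-1}.$$ In particular, if $(u^{R_e},\phi^{R_e})$ is, for all sufficiently large $R_e$, a global strong solution with these initial data, then for every $t\in[0,T_*]$ $$\|u^{R_e}(t)-v(t)\|_{L^2}^2+\lambda\|\phi^{R_e}(t)-\psi(t)\|_{H^1}^2\to0\qquad\text{as } R_e\to+\infty.$$ -/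

import Mathlib

open MeasureTheory Set Filter Topology
open scoped ENNReal ContDiff

noncomputable section

namespace MHD

/-- The plane `ℝ²` with its Euclidean structure. -/
abbrev Plane : Type := EuclideanSpace ℝ (Fin 2)

/-- Real-valued `L²(ℝ²)`, with Lebesgue measure. A vector field in `L²(ℝ²)²` is given by its two
components, that is, by a map `Fin 2 → L2`. -/
abbrev L2 : Type := Lp ℝ 2 (volume : Measure Plane)

/-- The classical partial derivative `∂ⱼ χ`, used for test functions only. -/
def partialD (j : Fin 2) (χ : Plane → ℝ) (x : Plane) : ℝ :=
  fderiv ℝ χ x (EuclideanSpace.single j 1)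

/-- `g` is the weak partial derivative `∂ⱼ f` on `ℝ²`: both are locally integrable and
`∫ f ∂ⱼχ = - ∫ g χ` for all `χ ∈ C_c^∞(ℝ²)`. -/
structure IsWeakPartial (j : Fin 2) (f g : Plane → ℝ) : Prop where
  locInt : LocallyIntegrable f volume
  locInt' : LocallyIntegrable g volume
  integral_eq : ∀ χ : Plane → ℝ, ContDiff ℝ ∞ χ → HasCompactSupport χ →
    ∫ x, f x * partialD j χ x = - ∫ x, g x * χ x

/-- Weak partial derivatives are unique almost everywhere. -/
theorem IsWeakPartial.ae_eq {j : Fin 2} {f g h : Plane → ℝ}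
    (hg : IsWeakPartial j f g) (hh : IsWeakPartial j f h) : g =ᵐ[volume] h := by
  refine ae_eq_of_integral_contDiff_smul_eq hg.locInt' hh.locInt' fun χ hχ hc => ?_
  have h1 := hg.integral_eq χ hχ hc
  have h2 := hh.integral_eq χ hχ hc
  simp only [smul_eq_mul, mul_comm (χ _)]
  linarith

open Classical in
/-- The weak partial derivative `∂ⱼ f ∈ L²` of `f ∈ L²` (and `0` if there is none in `L²`). -/
def weakD (j : Fin 2) (f : L2) : L2 :=
  if h : ∃ g : L2, IsWeakPartial j f g then h.choose else 0

/-- If `g ∈ L²` is the weak partial derivative of `f ∈ L²`, then `weakD j f` is `g`. -/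
theorem weakD_eq {j : Fin 2} {f g : L2} (hg : IsWeakPartial j f g) : weakD j f = g := by
  have h : ∃ g : L2, IsWeakPartial j f g := ⟨g, hg⟩
  rw [weakD, dif_pos h]
  exact Lp.ext (h.choose_spec.ae_eq hg)

/-- Membership in the Sobolev space `Hᵏ(ℝ²)`: all weak derivatives up to order `k` exist in
`L²(ℝ²)`. -/
def MemH : ℕ → L2 → Prop
  | 0, _ => True
  | k + 1, f => ∀ j : Fin 2, ∃ g : L2, IsWeakPartial j f g ∧ MemH k g

/-- The weak derivative `∂₁ᵃ ∂₂ᵇ f`. -/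
def weakDD (a b : ℕ) (f : L2) : L2 := (weakD 0)^[a] ((weakD 1)^[b] f)

/-- The squared Sobolev norm `|f|ₖ² = ∑_{a + b ≤ k} ‖∂₁ᵃ ∂₂ᵇ f‖²_{L²}`, for `f ∈ Hᵏ(ℝ²)`. -/
def hNormSq (k : ℕ) (f : L2) : ℝ :=
  ∑ a ∈ Finset.range (k + 1), ∑ b ∈ Finset.range (k + 1 - a), ‖weakDD a b f‖ ^ 2

/-- The Bochner space `Lᵖ(0, T; Hᵏ(ℝ²))`. As `Hᵏ` is isometric to a closed subspace of a finite
power of `L²` through its weak derivatives, a curve lies in this space iff it takes values in `Hᵏ`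
at almost every time and each weak derivative of order at most `k` lies in `Lᵖ(0, T; L²)`. -/
def MemLpH (p : ℝ≥0∞) (k : ℕ) (T : ℝ) (f : ℝ → L2) : Prop :=
  (∀ᵐ t ∂(volume.restrict (Ioo 0 T)), MemH k (f t)) ∧
    ∀ a b : ℕ, a + b ≤ k → MemLp (fun t => weakDD a b (f t)) p (volume.restrict (Ioo 0 T))

/-- `f` is an absolutely continuous curve `[0, T] → L²(ℝ²)` with time derivative
`f' ∈ L¹(0, T; L²)`, i.e. `f ∈ W^{1,1}(0, T; L²)` with its continuous representative chosen. -/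
def IsTimeDeriv (T : ℝ) (f f' : ℝ → L2) : Prop :=
  IntervalIntegrable f' volume 0 T ∧ ∀ t ∈ Icc 0 T, f t = f 0 + ∫ s in 0..t, f' s

/-- `∇ · u = 0` in the sense of distributions on `ℝ²`. -/
def DivFree (u : Fin 2 → L2) : Prop :=
  ∀ χ : Plane → ℝ, ContDiff ℝ ∞ χ → HasCompactSupport χ →
    ∑ i, ∫ x, u i x * partialD i χ x = 0

/-- The momentum equation at a fixed time, for the velocity `u` with time derivative `ut`:
`uₜ + (u · ∇) u + ∇p = ν Δu - S ∇ · (∇φ ⊗ ∇φ)` almost everywhere on `ℝ²`, for some pressure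
`p`. Here `G i = ∂ᵢ p` and `τ i j = ∂ⱼ (∂ᵢφ ∂ⱼφ)`. -/
def Momentum (ν S : ℝ) (u ut : Fin 2 → L2) (φ : L2) : Prop :=
  ∃ (p : Plane → ℝ) (G : Fin 2 → Plane → ℝ) (τ : Fin 2 → Fin 2 → Plane → ℝ),
    (∀ i, IsWeakPartial i p (G i)) ∧
    (∀ i j, IsWeakPartial j (fun x => weakD i φ x * weakD j φ x) (τ i j)) ∧
    ∀ i, ∀ᵐ x ∂(volume : Measure Plane),
      ut i x + ∑ j, u j x * weakD j (u i) x + G i x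
        = ν * ∑ j, weakD j (weakD j (u i)) x - S * ∑ j, τ i j x

/-- The flux-function equation at a fixed time, `φₜ + (u · ∇) φ = η Δφ` almost everywhere on
`ℝ²`. -/
def Flux (η : ℝ) (u : Fin 2 → L2) (φ φt : L2) : Prop :=
  ∀ᵐ x ∂(volume : Measure Plane),
    φt x + ∑ j, u j x * weakD j φ x = η * ∑ j, weakD j (weakD j φ) x

/-- `(u, φ)` satisfies on `ℝ² × [0, T]` the two-dimensional MHD system in flux-function form, with
initial data `(u₀, φ₀)`, viscosity `ν` (possibly `0`), magnetic diffusivity `η` and coupling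
constant `S`. The equations hold at almost every time, almost everywhere in space. -/
def SolvesMHD (ν η S T : ℝ) (u₀ : Fin 2 → L2) (φ₀ : L2)
    (u : ℝ → Fin 2 → L2) (φ : ℝ → L2) : Prop :=
  u 0 = u₀ ∧ φ 0 = φ₀ ∧ (∀ t ∈ Icc 0 T, DivFree (u t)) ∧
  ∃ (ut : ℝ → Fin 2 → L2) (φt : ℝ → L2),
    (∀ i, IsTimeDeriv T (fun t => u t i) (fun t => ut t i)) ∧ IsTimeDeriv T φ φt ∧
    ∀ᵐ t ∂(volume.restrict (Ioo 0 T)),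
      Momentum ν S (u t) (ut t) (φ t) ∧ Flux η (u t) (φ t) (φt t)

/-- Global strong solution of the viscous system with Reynolds number `Re` and magnetic Reynolds
number `Rm`: for all `T > 0`, `u ∈ L^∞(0,T;H¹) ∩ L²(0,T;H²)` is divergence free,
`φ ∈ L^∞(0,T;H²) ∩ L²(0,T;H³)`, and the system holds on `[0, T]`. -/
def IsGlobalStrongSolution (Re Rm S : ℝ) (u₀ : Fin 2 → L2) (φ₀ : L2)
    (u : ℝ → Fin 2 → L2) (φ : ℝ → L2) : Prop :=
  ∀ T : ℝ, 0 < T →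
    SolvesMHD (1 / Re) (1 / Rm) S T u₀ φ₀ u φ ∧
    (∀ i, MemLpH ∞ 1 T (fun t => u t i) ∧ MemLpH 2 2 T (fun t => u t i)) ∧
    MemLpH ∞ 2 T φ ∧ MemLpH 2 3 T φ

/-- Local smooth solution on `[0, T]` of the inviscid system, of Sobolev order `s`:
`v ∈ L^∞(0,T;H^s)` is divergence free, `ψ ∈ L^∞(0,T;H^{s+1})`, and the system holds with zero
viscosity. -/
def IsLocalSmoothSolution (s : ℕ) (Rm S T : ℝ) (v₀ : Fin 2 → L2) (ψ₀ : L2)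
    (v : ℝ → Fin 2 → L2) (ψ : ℝ → L2) : Prop :=
  SolvesMHD 0 (1 / Rm) S T v₀ ψ₀ v ψ ∧
    (∀ i, MemLpH ∞ s T (fun t => v t i)) ∧ MemLpH ∞ (s + 1) T ψ

/-- The error `|u - v|²_{L²} + lam |φ - ψ|²_{H¹}` at a fixed time. -/
def energyError (lam : ℝ) (u v : Fin 2 → L2) (φ ψ : L2) : ℝ :=
  ∑ i, ‖u i - v i‖ ^ 2 + lam * hNormSq 1 (φ - ψ)

end MHD

end

/-! The proof is an energy estimate for w = u - v and θ = φ - ψ, with energy E = ‖w‖² + ‖θ‖² +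
S‖∇θ‖², which vanishes at time 0. Up to a gradient the Lorentz force is -S ∇φ Δφ. The weight S in E
is chosen to cancel the worst coupling terms: testing the momentum difference with w produces -S Δθ
(w·∇φ), and testing the flux difference with -S Δθ produces +S Δθ (w·∇φ). The pressure and the
transport of w and θ by u contribute nothing, since u and w are divergence free. What is left is
quadratic in (w, θ, ∇θ) with coefficients v, ∇v, ∇ψ, Δψ, bounded by the embedding H² ⊂ L^∞, except
for S Δθ (v·∇θ), which the magnetic dissipation -Sη|Δθ|² absorbs (`quadratic_estimate`).

The only inhomogeneous term is the viscous one, and ν∫Δu·w ≤ (ν/4)‖∇v‖² (`viscous_term_le`). Hence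
E' ≤ 2K E + (ν/2) D, where K and D depend on the inviscid solution, S and η but not on u, φ or ν
(`energy_inequality`). Gronwall's inequality with ν = 1/Re gives the rate (`stability_estimate`).

Two points need care. The pressure is known only through its locally integrable gradient:
`Momentum.exists_total_pressure` uses the equation to place the total pressure gradient in L², and
`inner_grad_divFree` proves orthogonality on the Fourier side, with no decay of the pressure. Also,
θₜ is only in L¹(0,T;L²), so ‖∇θ‖² cannot be differentiated directly: `norm_sq_weakPartial_curve`
truncates frequencies and passes to the limit, which also yields θ(t) ∈ H¹ at every t rather than
almost every t. -/

noncomputable section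

/-! ### Weak derivatives and divergence on the Fourier side. -/

section FourierSide

open FourierTransform SchwartzMap
open scoped LineDeriv

namespace MHD

/-- The `j`-th standard basis vector of the plane. -/
abbrev basisVec (j : Fin 2) : Plane := EuclideanSpace.single j 1

lemma partialD_mul {j : Fin 2} {χ κ : Plane → ℝ} (hχ : ContDiff ℝ ∞ χ) (hκ : ContDiff ℝ ∞ κ)
    (x : Plane) : partialD j (fun y => χ y * κ y) x = χ x * partialD j κ x + κ x * partialD j χ x := by
  unfold partialD
  rw [fderiv_fun_mul (hχ.differentiable (by simp) x) (hκ.differentiable (by simp) x)]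
  simp

lemma continuous_partialD {j : Fin 2} {χ : Plane → ℝ} (hχ : ContDiff ℝ ∞ χ) :
    Continuous (partialD j χ) :=
  (hχ.continuous_fderiv (by simp)).clm_apply continuous_const

lemma contDiff_partialD {j : Fin 2} {χ : Plane → ℝ} (hχ : ContDiff ℝ ∞ χ) :
    ContDiff ℝ ∞ (partialD j χ) :=
  (hχ.fderiv_right (m := ∞) (by simp)).clm_apply contDiff_const

lemma hasCompactSupport_partialD {j : Fin 2} {χ : Plane → ℝ} (hc : HasCompactSupport χ) :
    HasCompactSupport (partialD j χ) :=
  hc.fderiv_apply (𝕜 := ℝ) _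

lemma memLp_test {χ : Plane → ℝ} (hχ : Continuous χ) (hc : HasCompactSupport χ) (p : ℝ≥0∞) :
    MemLp χ p volume := hχ.memLp_of_hasCompactSupport hc

lemma integrable_mul_L2 (f : L2) {g : Plane → ℝ} (hg : MemLp g 2 volume) :
    Integrable (fun x => f x * g x) volume :=
  (Lp.memLp f).integrable_mul hg

/-- A distributional divergence identity between `L²` functions extends from test functions to
smooth functions which are in `L²` with their first derivatives. -/
lemma divergence_identity_extend (f : Fin 2 → L2) (g : L2)
    (h : ∀ χ : Plane → ℝ, ContDiff ℝ ∞ χ → HasCompactSupport χ →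
      ∑ i, ∫ x, f i x * partialD i χ x = - ∫ x, g x * χ x)
    (χ : Plane → ℝ) (hχ : ContDiff ℝ ∞ χ) (h0 : MemLp χ 2 volume)
    (h1 : ∀ i, MemLp (partialD i χ) 2 volume) :
    ∑ i, ∫ x, f i x * partialD i χ x = - ∫ x, g x * χ x := by
  let ρ : ContDiffBump (0 : Plane) := ⟨1, 2, one_pos, one_lt_two⟩
  have hρ : ContDiff ℝ ∞ (ρ : Plane → ℝ) := ρ.contDiff
  -- The cutoffs ρ(cₙ x) tend to 1 while their gradients are O(cₙ), so the commutator with ∂ᵢ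
  -- vanishes in the limit by dominated convergence.
  let c : ℕ → ℝ := fun n => 1 / ((n : ℝ) + 1)
  have hc0 : ∀ n, 0 < c n := fun n => Nat.one_div_pos_of_nat
  have hc1 : ∀ n, c n ≤ 1 := fun n => by
    simp only [c]; rw [div_le_one (by positivity)]; linarith [(Nat.cast_nonneg n : (0:ℝ) ≤ n)]
  have hc : Tendsto c atTop (𝓝 0) := tendsto_one_div_add_atTop_nhds_zero_nat
  let r : ℕ → Plane → ℝ := fun n x => ρ (c n • x)
  have hr : ∀ n, ContDiff ℝ ∞ (r n) := fun n => hρ.comp (contDiff_const_smul (c n))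
  have hrc : ∀ n, HasCompactSupport (r n) := fun n =>
    ρ.hasCompactSupport.comp_homeomorph (Homeomorph.smulOfNeZero (c n) (hc0 n).ne')
  have hcx : ∀ x : Plane, Tendsto (fun n => c n • x) atTop (𝓝 0) := fun x => by
    simpa using hc.smul_const x
  have hr1 : ∀ x, Tendsto (fun n => r n x) atTop (𝓝 1) := fun x => by
    have : Tendsto (fun n => r n x) atTop (𝓝 (ρ 0)) := (hρ.continuous.tendsto 0).comp (hcx x)
    rwa [ρ.one_of_mem_closedBall (by simp [ρ])] at this
  have hrb : ∀ n x, |r n x| ≤ 1 := fun n x => by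
    rw [abs_of_nonneg ρ.nonneg]; exact ρ.le_one
  have hpr : ∀ i n x, partialD i (r n) x = c n * partialD i ρ (c n • x) := fun i n x => by
    unfold partialD
    have := fderiv_comp_smul (𝕜 := ℝ) (f := (ρ : Plane → ℝ)) (c n) (x := x)
    simp only [r]
    rw [this]; simp
  have hbd : ∀ i, ∃ C, ∀ x, ‖partialD i ρ x‖ ≤ C := fun i =>
    (hasCompactSupport_partialD ρ.hasCompactSupport).exists_bound_of_continuous
      (continuous_partialD hρ)
  choose C hC using hbd
  have key := fun n => h (fun x => r n x * χ x) ((hr n).mul hχ) ((hrc n).mul_right)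
  have lim1 : ∀ i, Tendsto (fun n => ∫ x, f i x * partialD i (fun x => r n x * χ x) x) atTop
      (𝓝 (∫ x, f i x * partialD i χ x)) := fun i => by
    apply tendsto_integral_of_dominated_convergence
      (fun x => |f i x * partialD i χ x| + C i * |f i x * χ x|)
    · intro n
      exact ((Lp.aestronglyMeasurable (f i)).mul
        (continuous_partialD ((hr n).mul hχ)).aestronglyMeasurable)
    · exact (integrable_mul_L2 (f i) (h1 i)).abs.add
        ((integrable_mul_L2 (f i) h0).abs.const_mul _)
    · intro n
      refine Eventually.of_forall fun x => ?_
      rw [partialD_mul (hr n) hχ, hpr, Real.norm_eq_abs]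
      have e : f i x * (r n x * partialD i χ x + χ x * (c n * partialD i ρ (c n • x)))
        = r n x * (f i x * partialD i χ x) + (c n * partialD i ρ (c n • x)) * (f i x * χ x) := by
        ring
      rw [e]
      refine (abs_add_le _ _).trans (add_le_add ?_ ?_)
      · rw [abs_mul]; exact mul_le_of_le_one_left (abs_nonneg _) (hrb n x)
      · rw [abs_mul]
        refine mul_le_mul_of_nonneg_right ?_ (abs_nonneg _)
        rw [abs_mul, abs_of_pos (hc0 n)]
        calc c n * |partialD i ρ (c n • x)| ≤ 1 * |partialD i ρ (c n • x)| :=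
              mul_le_mul_of_nonneg_right (hc1 n) (abs_nonneg _)
          _ ≤ C i := by rw [one_mul]; exact hC i _
    · refine Eventually.of_forall fun x => ?_
      simp_rw [partialD_mul (hr _) hχ, hpr]
      have : Tendsto (fun n => f i x * (r n x * partialD i χ x +
          χ x * (c n * partialD i ρ (c n • x)))) atTop
          (𝓝 (f i x * (1 * partialD i χ x + χ x * (0 * partialD i ρ 0)))) := by
        refine ((hr1 x).mul_const _ |>.add ((hc.mul ?_).const_mul _)).const_mul _
        exact ((continuous_partialD hρ).tendsto 0).comp (hcx x)
      simpa using this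
  have lim2 : Tendsto (fun n => - ∫ x, g x * (r n x * χ x)) atTop (𝓝 (- ∫ x, g x * χ x)) := by
    refine Tendsto.neg ?_
    apply tendsto_integral_of_dominated_convergence (fun x => |g x * χ x|)
    · intro n
      exact (Lp.aestronglyMeasurable g).mul
        ((hr n).continuous.mul hχ.continuous).aestronglyMeasurable
    · exact (integrable_mul_L2 g h0).abs
    · intro n
      refine Eventually.of_forall fun x => ?_
      rw [Real.norm_eq_abs, show g x * (r n x * χ x) = r n x * (g x * χ x) by ring, abs_mul]
      exact mul_le_of_le_one_left (abs_nonneg _) (hrb n x)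
    · refine Eventually.of_forall fun x => ?_
      simpa using ((hr1 x).mul_const (χ x)).const_mul (g x)
  have lim3 := tendsto_finsetSum Finset.univ (fun i _ => lim1 i)
  exact tendsto_nhds_unique (lim3.congr key) lim2

/-- Complexification of real `L²` functions. -/
def cplx : L2 →L[ℝ] Lp ℂ 2 (volume : Measure Plane) := Complex.ofRealCLM.compLpL 2 volume

lemma coeFn_cplx (f : L2) : cplx f =ᵐ[volume] fun x => (f x : ℂ) :=
  ContinuousLinearMap.coeFn_compLpL _ _

lemma integral_ofReal_mul (f : L2) {κ : Plane → ℂ} (hκ : MemLp κ 2 volume) :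
    ∫ x, (f x : ℂ) * κ x = (∫ x, f x * (κ x).re : ℝ) + (∫ x, f x * (κ x).im : ℝ) * Complex.I := by
  have h1 := integrable_mul_L2 f hκ.re
  have h2 := integrable_mul_L2 f hκ.im
  rw [← integral_complex_ofReal, ← integral_complex_ofReal, ← integral_mul_const, ← integral_add]
  · refine integral_congr_ae (Eventually.of_forall fun x => ?_)
    have := Complex.re_add_im (κ x)
    dsimp only
    conv_lhs => rw [← this]
    push_cast; ring
  · exact h1.ofReal
  · exact h2.ofReal.mul_const _

lemma memLp_lineDeriv (κ : 𝓢(Plane, ℂ)) (i : Fin 2) :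
    MemLp (fun x => (∂_{basisVec i} κ : 𝓢(Plane, ℂ)) x) 2 volume :=
  SchwartzMap.memLp (∂_{basisVec i} κ) 2 volume

lemma partialD_clm_comp (L : ℂ →L[ℝ] ℝ) (κ : 𝓢(Plane, ℂ)) (i : Fin 2) (x : Plane) :
    partialD i (fun y => L (κ y)) x = L ((∂_{basisVec i} κ : 𝓢(Plane, ℂ)) x) := by
  have hd : DifferentiableAt ℝ (κ : Plane → ℂ) x := (κ.smooth 1).differentiable (by simp) x
  rw [SchwartzMap.lineDerivOp_apply, hd.lineDeriv_eq_fderiv]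
  unfold partialD
  have := (L.hasFDerivAt.comp x hd.hasFDerivAt).fderiv
  rw [show (fun y => L (κ y)) = L ∘ κ from rfl, this]
  rfl

/-- The fields are real, so the identity splits into the real and imaginary parts of κ. Schwartz
test functions are needed because the Fourier transform does not preserve compact support. -/
lemma divergence_identity_schwartz (f : Fin 2 → L2) (g : L2)
    (h : ∀ χ : Plane → ℝ, ContDiff ℝ ∞ χ → HasCompactSupport χ →
      ∑ i, ∫ x, f i x * partialD i χ x = - ∫ x, g x * χ x) (κ : 𝓢(Plane, ℂ)) :
    ∑ i, ∫ x, (f i x : ℂ) * (∂_{basisVec i} κ : 𝓢(Plane, ℂ)) x = - ∫ x, (g x : ℂ) * κ x := by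
  have hL : ∀ L : ℂ →L[ℝ] ℝ,
      ∑ i, ∫ x, f i x * L ((∂_{basisVec i} κ : 𝓢(Plane, ℂ)) x) = - ∫ x, g x * L (κ x) := by
    intro L
    have := divergence_identity_extend f g h (fun y => L (κ y))
      (L.contDiff.comp (κ.smooth ⊤)) (L.comp_memLp' (κ.memLp 2))
      (fun i => by
        have e : partialD i (fun y => L (κ y)) =
          fun x => L ((∂_{basisVec i} κ : 𝓢(Plane, ℂ)) x) := funext (partialD_clm_comp L κ i)
        rw [e]; exact L.comp_memLp' (memLp_lineDeriv κ i))
    simpa only [partialD_clm_comp] using this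
  have hre := hL Complex.reCLM
  have him := hL Complex.imCLM
  simp only [Complex.reCLM_apply, Complex.imCLM_apply] at hre him
  rw [integral_ofReal_mul g (κ.memLp 2)]
  simp_rw [fun i => integral_ofReal_mul (f i) (memLp_lineDeriv κ i)]
  rw [Finset.sum_add_distrib, ← Finset.sum_mul]
  have e1 := congrArg (fun r : ℝ => (r : ℂ)) hre
  have e2 := congrArg (fun r : ℝ => (r : ℂ)) him
  push_cast at e1 e2
  rw [e1, e2]; ring

/-- The `L²` Fourier transform of a real-valued function. -/
def fhat : L2 →L[ℝ] Lp ℂ 2 (volume : Measure Plane) :=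
  ((Lp.fourierTransformₗᵢ Plane ℂ).toLinearIsometry.toContinuousLinearMap.restrictScalars ℝ).comp
    cplx

lemma fhat_apply (f : L2) : fhat f = 𝓕 (cplx f) := rfl

/-- The multiplication formula, read off from the agreement of the L² transform with that of
tempered distributions. -/
lemma integral_mul_fourier (f : L2) (η : 𝓢(Plane, ℂ)) :
    ∫ x, (f x : ℂ) * (𝓕 η : 𝓢(Plane, ℂ)) x = ∫ x, fhat f x * η x := by
  have h := Lp.fourier_toTemperedDistribution_eq (cplx f)
  have h2 := DFunLike.congr_fun h η
  rw [TemperedDistribution.fourier_apply] at h2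
  erw [Lp.toTemperedDistribution_apply, Lp.toTemperedDistribution_apply] at h2
  rw [fhat_apply]
  simp only [smul_eq_mul] at h2
  simp_rw [mul_comm _ (η _)]
  rw [← h2]
  refine integral_congr_ae ?_
  filter_upwards [coeFn_cplx f] with x hx
  rw [hx, mul_comm]

/-- The Fourier symbol of `∂ⱼ`. -/
def symb (j : Fin 2) (ξ : Plane) : ℂ := 2 * Real.pi * Complex.I * (ξ j : ℂ)

lemma smulLeft_inner_basisVec (η : 𝓢(Plane, ℂ)) (i : Fin 2) (x : Plane) :
    smulLeftCLM ℂ (fun y : Plane => inner ℝ y (basisVec i)) η x = (x i : ℂ) * η x := by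
  rw [smulLeftCLM_apply_apply (by fun_prop)]
  simp [basisVec, EuclideanSpace.inner_single_right]

lemma locallyIntegrable_L2 {E : Type*} [NormedAddCommGroup E] (f : Lp E 2 (volume : Measure Plane)) :
    LocallyIntegrable f volume :=
  (Lp.memLp f).locallyIntegrable one_le_two

lemma continuous_symb (j : Fin 2) : Continuous (symb j) := by
  unfold symb; fun_prop

/-- A distributional divergence identity between `L²` functions, on the Fourier side. -/
lemma fhat_divergence (f : Fin 2 → L2) (g : L2)
    (h : ∀ χ : Plane → ℝ, ContDiff ℝ ∞ χ → HasCompactSupport χ →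
      ∑ i, ∫ x, f i x * partialD i χ x = - ∫ x, g x * χ x) :
    ∀ᵐ ξ, fhat g ξ = ∑ i, symb i ξ * fhat (f i) ξ := by
  have hloc : LocallyIntegrable (fun ξ => ∑ i, symb i ξ * fhat (f i) ξ) volume := by
    refine locallyIntegrable_finsetSum _ fun i _ => ?_
    exact (locallyIntegrable_L2 (fhat (f i))).continuous_mul (continuous_symb i)
  refine ae_eq_of_integral_contDiff_smul_eq (locallyIntegrable_L2 _) hloc fun η hη hc => ?_
  -- Test on the frequency side with η and on the space side with its transform; `∂ᵢ` of that
  -- transform is the transform of η times minus the symbol.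
  let η' : 𝓢(Plane, ℂ) := (hc.comp_left (g := Complex.ofReal) rfl).toSchwartzMap
    (Complex.ofRealCLM.contDiff.comp hη)
  have hη' : ∀ x, η' x = (η x : ℂ) := fun x => rfl
  have key := divergence_identity_schwartz f g h (𝓕 η')
  rw [integral_mul_fourier] at key
  have e : ∀ i, ∫ x, (f i x : ℂ) * (∂_{basisVec i} (𝓕 η') : 𝓢(Plane, ℂ)) x
      = - ∫ x, η x • (symb i x * fhat (f i) x) := fun i => by
    rw [SchwartzMap.lineDerivOp_fourier_eq, integral_mul_fourier, ← integral_neg]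
    refine integral_congr_ae (Eventually.of_forall fun x => ?_)
    simp only [_root_.smul_apply, smulLeft_inner_basisVec, hη', symb, Complex.real_smul,
      smul_eq_mul]
    ring
  simp_rw [e, Finset.sum_neg_distrib, neg_inj] at key
  simp_rw [Finset.smul_sum]
  rw [integral_finsetSum, key]
  · refine integral_congr_ae (Eventually.of_forall fun x => ?_)
    simp only [hη', Complex.real_smul]
    ring
  · intro i _
    have := (locallyIntegrable_L2 (fhat (f i))).continuous_mul (continuous_symb i)
    exact this.integrable_smul_left_of_hasCompactSupport hη.continuous hc

lemma norm_cplx (f : L2) : ‖cplx f‖ = ‖f‖ := by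
  rw [Lp.norm_def, Lp.norm_def]
  congr 1
  refine eLpNorm_congr_norm_ae ?_
  filter_upwards [coeFn_cplx f] with x hx
  rw [hx]; simp

lemma norm_fhat (f : L2) : ‖fhat f‖ = ‖f‖ := by
  rw [fhat_apply, Lp.norm_fourier_eq, norm_cplx]

lemma inner_fhat (f g : L2) : inner ℝ (fhat f) (fhat g) = inner ℝ f g := by
  let A : L2 →ₗᵢ[ℝ] Lp ℂ 2 (volume : Measure Plane) := ⟨fhat.toLinearMap, norm_fhat⟩
  exact A.inner_map_map f g

lemma inner_L2_eq (f g : L2) : inner ℝ f g = ∫ x, f x * g x := by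
  rw [L2.inner_def]
  refine integral_congr_ae (Eventually.of_forall fun x => ?_)
  simp [mul_comm]

lemma IsWeakPartial.congr {j : Fin 2} {f f' g g' : Plane → ℝ} (h : IsWeakPartial j f g)
    (hf : f =ᵐ[volume] f') (hg : g =ᵐ[volume] g') : IsWeakPartial j f' g' where
  locInt := h.locInt.congr hf
  locInt' := h.locInt'.congr hg
  integral_eq χ hχ hc := by
    have e1 := integral_congr_ae (hf.mul (ae_eq_refl (partialD j χ)))
    have e2 := integral_congr_ae (hg.mul (ae_eq_refl χ))
    simp only [Pi.mul_apply] at e1 e2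
    rw [← e1, h.integral_eq χ hχ hc, e2]

lemma integrable_mul_test {f : Plane → ℝ} (hf : LocallyIntegrable f volume)
    {χ : Plane → ℝ} (hχ : Continuous χ) (hc : HasCompactSupport χ) :
    Integrable (fun x => f x * χ x) volume := by
  simpa [mul_comm] using hf.integrable_smul_left_of_hasCompactSupport hχ hc

lemma IsWeakPartial.sub {j : Fin 2} {f f' g g' : Plane → ℝ} (h : IsWeakPartial j f g)
    (h' : IsWeakPartial j f' g') : IsWeakPartial j (fun x => f x - f' x) (fun x => g x - g' x) where
  locInt := h.locInt.sub h'.locInt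
  locInt' := h.locInt'.sub h'.locInt'
  integral_eq χ hχ hc := by
    have hp := hasCompactSupport_partialD (j := j) hc
    have hp' := continuous_partialD (j := j) hχ
    simp_rw [sub_mul]
    rw [integral_sub (integrable_mul_test h.locInt hp' hp) (integrable_mul_test h'.locInt hp' hp),
      integral_sub (integrable_mul_test h.locInt' hχ.continuous hc)
        (integrable_mul_test h'.locInt' hχ.continuous hc),
      h.integral_eq χ hχ hc, h'.integral_eq χ hχ hc]
    ring

lemma IsWeakPartial.add {j : Fin 2} {f f' g g' : Plane → ℝ} (h : IsWeakPartial j f g)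
    (h' : IsWeakPartial j f' g') : IsWeakPartial j (fun x => f x + f' x) (fun x => g x + g' x) where
  locInt := h.locInt.add h'.locInt
  locInt' := h.locInt'.add h'.locInt'
  integral_eq χ hχ hc := by
    have hp := hasCompactSupport_partialD (j := j) hc
    have hp' := continuous_partialD (j := j) hχ
    simp_rw [add_mul]
    rw [integral_add (integrable_mul_test h.locInt hp' hp) (integrable_mul_test h'.locInt hp' hp),
      integral_add (integrable_mul_test h.locInt' hχ.continuous hc)
        (integrable_mul_test h'.locInt' hχ.continuous hc),
      h.integral_eq χ hχ hc, h'.integral_eq χ hχ hc]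
    ring

lemma IsWeakPartial.const_mul {j : Fin 2} {f g : Plane → ℝ} (h : IsWeakPartial j f g) (c : ℝ) :
    IsWeakPartial j (fun x => c * f x) (fun x => c * g x) where
  locInt := h.locInt.smul c
  locInt' := h.locInt'.smul c
  integral_eq χ hχ hc := by
    simp_rw [mul_assoc]
    rw [integral_const_mul, integral_const_mul, h.integral_eq χ hχ hc]
    ring

lemma IsWeakPartial.sub_L2 {j : Fin 2} {f f' g g' : L2} (h : IsWeakPartial j f g)
    (h' : IsWeakPartial j f' g') : IsWeakPartial j (f - f' : L2) (g - g' : L2) :=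
  (h.sub h').congr (Lp.coeFn_sub f f').symm (Lp.coeFn_sub g g').symm

lemma fhat_weakPartial {j : Fin 2} {f g : L2} (h : IsWeakPartial j f g) :
    ∀ᵐ ξ, fhat g ξ = symb j ξ * fhat f ξ := by
  have hz : ∀ χ : Plane → ℝ, ∫ x, (0 : L2) x * χ x = 0 := fun χ => by simp
  -- A partial derivative is the divergence of a field whose only component is the j-th.
  have key := fhat_divergence (fun i => if i = j then f else 0) g (fun χ hχ hc => by
    rw [← h.integral_eq χ hχ hc, Finset.sum_eq_single j]
    · simp
    · intro b _ hb; simp only [hb, if_false]; exact hz _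
    · simp)
  filter_upwards [key] with ξ h1
  rw [h1, Finset.sum_eq_single j]
  · simp
  · intro b _ hb; simp [hb]
  · simp

/-- The symbol is purely imaginary; this is the source of the minus sign in integration by parts. -/
lemma conj_symb (j : Fin 2) (ξ : Plane) : (starRingEnd ℂ) (symb j ξ) = - symb j ξ := by
  simp only [symb, map_mul, Complex.conj_I, Complex.conj_ofReal, map_ofNat]
  ring

/-- Integration by parts in `H¹`. -/
lemma inner_weakPartial {j : Fin 2} {f f' g g' : L2} (hf : IsWeakPartial j f f')
    (hg : IsWeakPartial j g g') : inner ℝ f' g = - inner ℝ f g' := by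
  rw [← inner_fhat, ← inner_fhat, L2.inner_def, L2.inner_def, ← integral_neg]
  refine integral_congr_ae ?_
  filter_upwards [fhat_weakPartial hf, fhat_weakPartial hg] with ξ h1 h2
  rw [h1, h2, Complex.inner, Complex.inner, map_mul, conj_symb, ← Complex.neg_re]
  congr 1; ring

/-- Converse of `fhat_weakPartial`: a function whose Fourier transform times the symbol of `∂ⱼ` is
in `L²` has a weak partial derivative in `L²`. -/
lemma exists_weakPartial {j : Fin 2} {f : L2} {G : Lp ℂ 2 (volume : Measure Plane)}
    (hG : ∀ᵐ ξ, G ξ = symb j ξ * fhat f ξ) : ∃ g : L2, IsWeakPartial j f g := by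
  let H : Lp ℂ 2 (volume : Measure Plane) := 𝓕⁻ G
  have hH : ∀ η : 𝓢(Plane, ℂ), ∫ x, (𝓕 η : 𝓢(Plane, ℂ)) x * H x = ∫ x, η x * G x := fun η => by
    have h2 := DFunLike.congr_fun (Lp.fourier_toTemperedDistribution_eq H) η
    rw [TemperedDistribution.fourier_apply] at h2
    erw [Lp.toTemperedDistribution_apply, Lp.toTemperedDistribution_apply] at h2
    simp only [H, fourier_fourierInv_eq] at h2
    simpa only [smul_eq_mul] using h2
  -- The inverse transform is a priori complex; since f and the test functions are real, its real
  -- part already satisfies the identity.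
  let g : L2 := Complex.reCLM.compLp H
  have hg : ∀ᵐ x, g x = (H x).re := Complex.reCLM.coeFn_compLp H
  refine ⟨g, locallyIntegrable_L2 f, locallyIntegrable_L2 g, fun χ hχ hc => ?_⟩
  let κ : 𝓢(Plane, ℂ) := (hc.comp_left (g := Complex.ofReal) rfl).toSchwartzMap
    (Complex.ofRealCLM.contDiff.comp hχ)
  have hκ : ∀ x, κ x = (χ x : ℂ) := fun x => rfl
  have hd : ∀ x, (∂_{basisVec j} κ : 𝓢(Plane, ℂ)) x = (partialD j χ x : ℂ) := fun x => by
    rw [SchwartzMap.lineDerivOp_apply,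
      ((κ.smooth 1).differentiable (by simp) x).lineDeriv_eq_fderiv]
    have := (Complex.ofRealCLM.hasFDerivAt.comp x
      (hχ.differentiable (by simp) x).hasFDerivAt).fderiv
    rw [show (κ : Plane → ℂ) = Complex.ofRealCLM ∘ χ from rfl, this]
    rfl
  have e1 : κ = 𝓕 (𝓕⁻ κ) := (fourier_fourierInv_eq κ).symm
  have e2 : ∫ x, (f x : ℂ) * (∂_{basisVec j} κ : 𝓢(Plane, ℂ)) x = - ∫ x, κ x * H x := by
    rw [e1, SchwartzMap.lineDerivOp_fourier_eq, integral_mul_fourier, hH, ← integral_neg]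
    refine integral_congr_ae ?_
    filter_upwards [hG] with x hx
    rw [hx]
    simp only [_root_.smul_apply, smulLeft_inner_basisVec, symb, smul_eq_mul]
    ring
  have e3 : ((∫ x, f x * partialD j χ x : ℝ) : ℂ) = - ∫ x, κ x * H x := by
    rw [← e2, ← integral_complex_ofReal]
    refine integral_congr_ae (Eventually.of_forall fun x => ?_)
    simp only [hd, Complex.ofReal_mul]
  have hint : Integrable (fun x => κ x * H x) volume :=
    (κ.memLp 2).integrable_mul (Lp.memLp H)
  have e4 := congrArg Complex.reCLM e3
  rw [map_neg, ← Complex.reCLM.integral_comp_comm hint] at e4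
  simp only [Complex.reCLM_apply, Complex.ofReal_re] at e4
  rw [e4]
  congr 1
  refine integral_congr_ae ?_
  filter_upwards [hg] with x hx
  rw [hx, hκ]
  simp [mul_comm]

lemma partialD_comm {χ : Plane → ℝ} (hχ : ContDiff ℝ ∞ χ) (i j : Fin 2) (x : Plane) :
    partialD i (partialD j χ) x = partialD j (partialD i χ) x := by
  have hd : DifferentiableAt ℝ (fderiv ℝ χ) x :=
    (hχ.fderiv_right (m := ∞) (by simp)).differentiable (by simp) x
  have e : ∀ k l : Fin 2, partialD k (partialD l χ) x
      = fderiv ℝ (fderiv ℝ χ) x (basisVec k) (basisVec l) := fun k l => by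
    have := (hd.hasFDerivAt.clm_apply (hasFDerivAt_const (basisVec l) x)).fderiv
    unfold partialD
    rw [this]; simp
  rw [e, e]
  exact second_derivative_symmetric (f := χ)
    (fun y => (hχ.differentiable (by simp) y).hasFDerivAt) hd.hasFDerivAt _ _

/-- A gradient in `L²` is orthogonal to the divergence-free vector fields. -/
lemma inner_grad_divFree {p : Plane → ℝ} {G u : Fin 2 → L2} (hG : ∀ i, IsWeakPartial i p (G i))
    (hu : DivFree u) : ∑ i, inner ℝ (G i) (u i) = 0 := by
  have hz : ∀ χ : Plane → ℝ, ∫ x, (0 : L2) x * χ x = 0 := fun χ => by simp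
  have h0 : ∀ᵐ ξ, fhat (0 : L2) ξ = 0 := by
    rw [map_zero]; exact Lp.coeFn_zero _ _ _
  have h1 := fhat_divergence u 0 (fun χ hχ hc => by rw [hu χ hχ hc, hz, neg_zero])
  -- A gradient is curl free, so its rotation is divergence free. Only the pairing of p with second
  -- derivatives of test functions is used, so p itself need not have a Fourier transform.
  have h2 := fhat_divergence ![-G 1, G 0] 0 (fun χ hχ hc => by
    rw [hz, neg_zero, Fin.sum_univ_two]
    simp only [Matrix.cons_val_zero, Matrix.cons_val_one]
    have a := (hG 0).integral_eq _ (contDiff_partialD (j := 1) hχ) (hasCompactSupport_partialD hc)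
    have b := (hG 1).integral_eq _ (contDiff_partialD (j := 0) hχ) (hasCompactSupport_partialD hc)
    simp_rw [partialD_comm hχ 1 0] at b
    have c : ∫ x, (-G 1 : L2) x * partialD 0 χ x = - ∫ x, G 1 x * partialD 0 χ x := by
      rw [← integral_neg]
      refine integral_congr_ae ?_
      filter_upwards [Lp.coeFn_neg (G 1)] with x hx
      rw [hx]; simp
    rw [c]; linarith)
  have h3 : ∀ᵐ ξ, fhat (-G 1) ξ = - fhat (G 1) ξ := by
    rw [map_neg]; exact Lp.coeFn_neg _
  have hne : ∀ᵐ ξ : Plane, ξ ≠ 0 := by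
    have : (volume : Measure Plane) {0} = 0 := measure_singleton 0
    exact compl_mem_ae_iff.mpr this
  rw [Fin.sum_univ_two, ← inner_fhat, ← inner_fhat, L2.inner_def, L2.inner_def,
    ← integral_add (L2.integrable_inner _ _) (L2.integrable_inner _ _)]
  refine integral_eq_zero_of_ae ?_
  filter_upwards [h0, h1, h2, h3, hne] with ξ a0 a1 a2 a3 hξ
  rw [a0] at a1 a2
  simp only [Fin.sum_univ_two, Matrix.cons_val_zero, Matrix.cons_val_one, a3] at a1 a2
  rw [Complex.inner, Complex.inner, ← Complex.add_re]
  have hI : (2 * Real.pi * Complex.I : ℂ) ≠ 0 := by simp [Real.pi_ne_zero]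
  have b1 : (ξ 0 : ℂ) * fhat (u 0) ξ + (ξ 1 : ℂ) * fhat (u 1) ξ = 0 := by
    refine (mul_eq_zero.mp (?_ : (2 * Real.pi * Complex.I : ℂ) * _ = 0)).resolve_left hI
    rw [a1]; unfold symb; ring
  have b2 : (ξ 1 : ℂ) * fhat (G 0) ξ - (ξ 0 : ℂ) * fhat (G 1) ξ = 0 := by
    refine (mul_eq_zero.mp (?_ : (2 * Real.pi * Complex.I : ℂ) * _ = 0)).resolve_left hI
    rw [a2]; unfold symb; ring
  have b3 := congrArg (starRingEnd ℂ) b2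
  simp only [map_sub, map_mul, Complex.conj_ofReal, map_zero] at b3
  have hs : ((ξ 0 : ℂ) ^ 2 + (ξ 1 : ℂ) ^ 2) ≠ 0 := by
    have : (ξ 0) ^ 2 + (ξ 1) ^ 2 ≠ 0 := by
      intro h
      apply hξ
      ext i
      fin_cases i
      · simp; nlinarith [sq_nonneg (ξ 0), sq_nonneg (ξ 1)]
      · simp; nlinarith [sq_nonneg (ξ 0), sq_nonneg (ξ 1)]
    intro h
    rw [← Complex.ofReal_pow, ← Complex.ofReal_pow, ← Complex.ofReal_add] at h
    exact this (Complex.ofReal_eq_zero.mp h)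
  -- In frequency the gradient is parallel to ξ and û is orthogonal to ξ; multiplying by |ξ|² turns
  -- this into a linear combination of the two relations.
  have : (starRingEnd ℂ) (fhat (G 0) ξ) * fhat (u 0) ξ
      + (starRingEnd ℂ) (fhat (G 1) ξ) * fhat (u 1) ξ = 0 := by
    refine (mul_eq_zero.mp (?_ : ((ξ 0 : ℂ) ^ 2 + (ξ 1 : ℂ) ^ 2) * _ = 0)).resolve_left hs
    linear_combination ((starRingEnd ℂ) (fhat (G 0) ξ) * ξ 0 + (starRingEnd ℂ) (fhat (G 1) ξ) * ξ 1)
      * b1 + (fhat (u 0) ξ * ξ 1 - fhat (u 1) ξ * ξ 0) * b3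
  rw [mul_comm (fhat (u 0) ξ), mul_comm (fhat (u 1) ξ)] at *
  simp [this]

/-! ### The Sobolev embedding H² ⊂ L^∞. -/

/-- The square-integrable weight `(1 + |ξ|²)⁻¹` on the plane. -/
lemma memLp_weight : MemLp (fun ξ : Plane => (1 + ‖ξ‖ ^ 2)⁻¹) 2 volume := by
  have hcont : Continuous (fun ξ : Plane => (1 + ‖ξ‖ ^ 2)⁻¹) := by
    refine Continuous.inv₀ (by fun_prop) fun ξ => by positivity
  rw [memLp_two_iff_integrable_sq hcont.aestronglyMeasurable]
  -- The squared weight decays like |ξ|⁻⁴, and 4 exceeds the dimension 2.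
  have := integrable_rpow_neg_one_add_norm_sq (E := Plane) (μ := volume) (r := 4)
    (by simp; norm_num)
  refine this.congr (Eventually.of_forall fun ξ => ?_)
  have h : (0:ℝ) < 1 + ‖ξ‖ ^ 2 := by positivity
  simp only
  rw [show (-4 / 2 : ℝ) = -((2 : ℕ) : ℝ) by norm_num, Real.rpow_neg h.le, Real.rpow_natCast, inv_pow]

lemma integral_weight_mul_le (F : Lp ℂ 2 (volume : Measure Plane)) :
    ∫ ξ : Plane, (1 + ‖ξ‖ ^ 2)⁻¹ * ‖F ξ‖ ≤ ‖memLp_weight.toLp‖ * ‖F‖ := by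
  have hF := (Lp.memLp F).norm
  have h := real_inner_le_norm (memLp_weight.toLp) hF.toLp
  have e : ‖hF.toLp‖ = ‖F‖ := by
    rw [Lp.norm_toLp, eLpNorm_norm, Lp.norm_def]
  rw [e, inner_L2_eq] at h
  refine le_trans (le_of_eq (integral_congr_ae ?_)) h
  filter_upwards [hF.coeFn_toLp, memLp_weight.coeFn_toLp] with x h1 h2
  rw [h1, h2]

/-- If the Fourier transform of `f ∈ L²` is integrable then `f` is bounded by its `L¹` norm. -/
lemma ae_abs_le_of_integrable_fhat {f : L2} (hf : Integrable (fhat f) volume) :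
    ∀ᵐ x, |f x| ≤ ∫ ξ, ‖fhat f ξ‖ := by
  -- The minus sign makes the transform below the inverse Fourier transform, whose continuous
  -- representative is then identified with f by duality.
  let L : Plane →ₗ[ℝ] Plane →ₗ[ℝ] ℝ := -innerₗ Plane
  have hL : Continuous fun p : Plane × Plane => L p.1 p.2 := by
    simp only [L, LinearMap.neg_apply, innerₗ_apply_apply]; fun_prop
  let h : Plane → ℂ := VectorFourier.fourierIntegral Real.fourierChar volume L (fhat f)
  have hb : ∀ x, ‖h x‖ ≤ ∫ ξ, ‖fhat f ξ‖ := fun x =>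
    VectorFourier.norm_fourierIntegral_le_integral_norm _ _ _ _ _
  have hcont : Continuous h :=
    VectorFourier.fourierIntegral_continuous Real.continuous_fourierChar hL hf
  have hloc : LocallyIntegrable (cplx f) volume := locallyIntegrable_L2 _
  have key : ∀ᵐ x, cplx f x = h x := by
    refine ae_eq_of_integral_contDiff_smul_eq hloc hcont.locallyIntegrable fun χ hχ hc => ?_
    let κ : 𝓢(Plane, ℂ) := (hc.comp_left (g := Complex.ofReal) rfl).toSchwartzMap
      (Complex.ofRealCLM.contDiff.comp hχ)
    have hκ : ∀ x, κ x = (χ x : ℂ) := fun x => rfl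
    have h1 := integral_mul_fourier f (𝓕⁻ κ)
    rw [fourier_fourierInv_eq] at h1
    have h2 : ∫ ξ, h ξ • κ ξ = ∫ x, fhat f x • (VectorFourier.fourierIntegral Real.fourierChar
        volume L.flip κ) x :=
      VectorFourier.integral_fourierIntegral_smul_eq_flip Real.continuous_fourierChar hL hf
        κ.integrable
    have h3 : ∀ x, VectorFourier.fourierIntegral Real.fourierChar volume L.flip κ x
        = (𝓕⁻ κ : 𝓢(Plane, ℂ)) x := fun x => by
      rw [SchwartzMap.fourierInv_coe, Real.fourierInv_eq]
      unfold VectorFourier.fourierIntegral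
      simp [L, real_inner_comm]
    simp only [h3, smul_eq_mul] at h2
    rw [← h2] at h1
    calc ∫ x, χ x • cplx f x = ∫ x, (f x : ℂ) * κ x := by
          refine integral_congr_ae ?_
          filter_upwards [coeFn_cplx f] with x hx
          rw [hx, hκ, Complex.real_smul, mul_comm]
      _ = ∫ x, h x * κ x := h1
      _ = _ := by
          refine integral_congr_ae (Eventually.of_forall fun x => ?_)
          simp only [hκ, Complex.real_smul, mul_comm]
  filter_upwards [key, coeFn_cplx f] with x h1 h2
  have := hb x
  rw [← h1, h2] at this
  simpa using this

/-- The Sobolev embedding `H² ⊂ L^∞` in the plane. -/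
lemma exists_sobolev_const : ∃ C : ℝ, 0 ≤ C ∧ ∀ f : L2, ∀ f₁ f₂ : Fin 2 → L2,
    (∀ j, IsWeakPartial j f (f₁ j)) → (∀ j, IsWeakPartial j (f₁ j) (f₂ j)) →
    ∀ᵐ x, |f x| ≤ C * (‖f‖ + ∑ j, ‖f₂ j‖) := by
  refine ⟨‖memLp_weight.toLp‖, norm_nonneg _, fun f f₁ f₂ h1 h2 => ?_⟩
  have hpt : ∀ᵐ ξ : Plane, ‖fhat f ξ‖ ≤ (1 + ‖ξ‖ ^ 2)⁻¹ * ‖fhat f ξ‖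
      + ((1 + ‖ξ‖ ^ 2)⁻¹ * ‖fhat (f₂ 0) ξ‖ + (1 + ‖ξ‖ ^ 2)⁻¹ * ‖fhat (f₂ 1) ξ‖) := by
    filter_upwards [fhat_weakPartial (h1 0), fhat_weakPartial (h1 1), fhat_weakPartial (h2 0),
      fhat_weakPartial (h2 1)] with ξ a0 a1 b0 b1
    rw [b0, b1, a0, a1]
    -- The pure second derivatives control |ξ|² f̂, since |2πξⱼ|² ≥ ξⱼ².
    have hs : ∀ j, (ξ j) ^ 2 * ‖fhat f ξ‖ ≤ ‖symb j ξ * (symb j ξ * fhat f ξ)‖ := fun j => by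
      rw [← mul_assoc, norm_mul]
      refine mul_le_mul_of_nonneg_right ?_ (norm_nonneg _)
      simp only [symb, norm_mul, Complex.norm_real, Complex.norm_I, Complex.norm_ofNat, mul_one]
      have hp : (1:ℝ) ≤ ‖Real.pi‖ := by
        rw [Real.norm_of_nonneg Real.pi_pos.le]; linarith [Real.two_le_pi]
      have e : ‖ξ j‖ * ‖ξ j‖ = (ξ j) ^ 2 := by rw [Real.norm_eq_abs, ← sq, sq_abs]
      have : 2 * ‖Real.pi‖ * ‖ξ j‖ * (2 * ‖Real.pi‖ * ‖ξ j‖) = 4 * ‖Real.pi‖ ^ 2 * (ξ j) ^ 2 := by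
        rw [← e]; ring
      rw [this]
      have : (1:ℝ) ≤ 4 * ‖Real.pi‖ ^ 2 := by nlinarith
      nlinarith [sq_nonneg (ξ j)]
    have hn : ‖ξ‖ ^ 2 = (ξ 0) ^ 2 + (ξ 1) ^ 2 := by
      rw [EuclideanSpace.norm_sq_eq, Fin.sum_univ_two]; simp
    rw [← mul_add, ← mul_add, inv_mul_eq_div, le_div_iff₀ (by positivity)]
    have := hs 0
    have := hs 1
    rw [hn]; linarith
  have hint : ∀ F : Lp ℂ 2 (volume : Measure Plane),
      Integrable (fun ξ : Plane => (1 + ‖ξ‖ ^ 2)⁻¹ * ‖F ξ‖) volume := fun F =>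
    memLp_weight.integrable_mul (Lp.memLp F).norm
  have hint' := (hint (fhat f)).add ((hint (fhat (f₂ 0))).add (hint (fhat (f₂ 1))))
  have hI : Integrable (fhat f) volume := hint'.mono' (Lp.aestronglyMeasurable _) hpt
  filter_upwards [ae_abs_le_of_integrable_fhat hI] with x hx
  refine hx.trans ?_
  calc ∫ ξ, ‖fhat f ξ‖ ≤ _ := integral_mono_ae hI.norm hint' hpt
    _ = (∫ ξ : Plane, (1 + ‖ξ‖ ^ 2)⁻¹ * ‖fhat f ξ‖) + ((∫ ξ : Plane, (1 + ‖ξ‖ ^ 2)⁻¹ *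
        ‖fhat (f₂ 0) ξ‖) + ∫ ξ : Plane, (1 + ‖ξ‖ ^ 2)⁻¹ * ‖fhat (f₂ 1) ξ‖) := by
      rw [integral_add' (hint _) ((hint _).add (hint _)), integral_add' (hint _) (hint _)]
    _ ≤ _ := by
      have a := integral_weight_mul_le (fhat f)
      have b := integral_weight_mul_le (fhat (f₂ 0))
      have c := integral_weight_mul_le (fhat (f₂ 1))
      rw [norm_fhat] at a b c
      rw [Fin.sum_univ_two]
      linarith

end MHD

end FourierSide

/-! ### Product rule and transport by a divergence-free field. -/

namespace MHD

lemma integrable_L2_mul (f g : L2) : Integrable (fun x => f x * g x) volume :=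
  integrable_mul_L2 f (Lp.memLp g)

lemma inner_toLp_right (f : L2) {g : Plane → ℝ} (hg : MemLp g 2 volume) :
    inner ℝ f (hg.toLp : L2) = ∫ x, f x * g x := by
  rw [inner_L2_eq]
  refine integral_congr_ae ?_
  filter_upwards [hg.coeFn_toLp] with x hx
  rw [hx]

lemma memLp_L2_mul_test (f : L2) {χ : Plane → ℝ} (hχ : Continuous χ) (hc : HasCompactSupport χ) :
    MemLp (fun x => f x * χ x) 2 volume := by
  obtain ⟨C, hC⟩ := hc.exists_bound_of_continuous hχ
  have h : MemLp χ ∞ volume := memLp_top_of_bound hχ.aestronglyMeasurable C (Eventually.of_forall hC)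
  exact h.mul' (Lp.memLp f)

/-- The Leibniz rule for a weak partial derivative times a test function. -/
lemma IsWeakPartial.mul_test {j : Fin 2} {f g χ : Plane → ℝ} (h : IsWeakPartial j f g)
    (hχ : ContDiff ℝ ∞ χ) :
    IsWeakPartial j (fun x => f x * χ x) (fun x => g x * χ x + f x * partialD j χ x) where
  locInt := h.locInt.mul_continuous hχ.continuous
  locInt' := (h.locInt'.mul_continuous hχ.continuous).add
    (h.locInt.mul_continuous (continuous_partialD hχ))
  integral_eq κ hκ hc := by
    have key := h.integral_eq (fun x => χ x * κ x) (hχ.mul hκ) hc.mul_left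
    simp only [partialD_mul hχ hκ] at key
    have i1 : Integrable (fun x => f x * (χ x * partialD j κ x)) volume :=
      integrable_mul_test h.locInt (hχ.continuous.mul (continuous_partialD hκ))
        (hasCompactSupport_partialD hc).mul_left
    have i2 : Integrable (fun x => f x * (partialD j χ x * κ x)) volume :=
      integrable_mul_test h.locInt ((continuous_partialD hχ).mul hκ.continuous) hc.mul_left
    have i3 : Integrable (fun x => g x * (χ x * κ x)) volume :=
      integrable_mul_test h.locInt' (hχ.continuous.mul hκ.continuous) hc.mul_left
    have e1 : ∀ x, f x * (χ x * partialD j κ x + κ x * partialD j χ x)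
        = f x * (χ x * partialD j κ x) + f x * (partialD j χ x * κ x) := fun x => by ring
    have e2 : ∀ x, (g x * χ x + f x * partialD j χ x) * κ x
        = g x * (χ x * κ x) + f x * (partialD j χ x * κ x) := fun x => by ring
    simp_rw [e1] at key
    rw [integral_add i1 i2] at key
    simp_rw [e2, mul_assoc]
    rw [integral_add i3 i2]
    linarith

/-- The product rule for two functions in `H¹`. -/
lemma IsWeakPartial.mul {j : Fin 2} {f f' g g' : L2} (hf : IsWeakPartial j f f')
    (hg : IsWeakPartial j g g') :
    IsWeakPartial j (fun x => f x * g x) (fun x => f' x * g x + f x * g' x) where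
  locInt := (integrable_L2_mul f g).locallyIntegrable
  locInt' := ((integrable_L2_mul f' g).add (integrable_L2_mul f g')).locallyIntegrable
  integral_eq χ hχ hc := by
    have hcp := hasCompactSupport_partialD (j := j) hc
    have hχp := continuous_partialD (j := j) hχ
    have m0 := memLp_L2_mul_test g hχ.continuous hc
    have m1 := memLp_L2_mul_test g' hχ.continuous hc
    have m2 := memLp_L2_mul_test g hχp hcp
    have m3 := m1.add m2
    -- Putting the test function on g makes gχ an H¹ function, and the product rule becomes
    -- integration by parts of f against gχ.
    have hh : IsWeakPartial j (m0.toLp : L2) (m3.toLp : L2) :=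
      (hg.mul_test hχ).congr m0.coeFn_toLp.symm m3.coeFn_toLp.symm
    have key := inner_weakPartial hf hh
    rw [inner_toLp_right, inner_toLp_right] at key
    simp only [Pi.add_apply] at key
    have i0 := integrable_mul_L2 f' m0
    have i1 := integrable_mul_L2 f m1
    have i2 := integrable_mul_L2 f m2
    simp_rw [mul_add] at key
    rw [integral_add i1 i2] at key
    have e : ∀ x, (f' x * g x + f x * g' x) * χ x = f' x * (g x * χ x) + f x * (g' x * χ x) :=
      fun x => by ring
    simp_rw [e, mul_assoc]
    rw [integral_add i0 i1]
    linarith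

/-- Multiplication of an `L²` function by a bounded `L²` function. -/
lemma memLp_bdd_mul (f g : L2) {B : ℝ} (hf : ∀ᵐ x, |f x| ≤ B) :
    MemLp (fun x => f x * g x) 2 volume :=
  (Lp.memLp g).mul' (memLp_top_of_bound (Lp.aestronglyMeasurable f) B hf)

/-- Transport by a divergence-free field does not change the `L²` norm. -/
lemma integral_transport_eq_zero {u : Fin 2 → L2} (hu : DivFree u) {w : L2} {w' : Fin 2 → L2}
    (hw : ∀ j, IsWeakPartial j w (w' j)) {B : ℝ} (hB : ∀ᵐ x, |w x| ≤ B) :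
    ∫ x, (∑ j, u j x * w' j x) * w x = 0 := by
  have hm : ∀ j, MemLp (fun x => w x * w' j x) 2 volume := fun j => memLp_bdd_mul w (w' j) hB
  -- The field w∇w = ∇(w²/2) is an L² gradient because w is bounded, hence orthogonal to u.
  have hp : ∀ j, IsWeakPartial j (fun x => (1 / 2) * (w x * w x)) ((hm j).toLp : L2) := fun j =>
    (((hw j).mul (hw j)).const_mul (1 / 2)).congr (ae_eq_refl _) <| by
      filter_upwards [(hm j).coeFn_toLp] with x hx
      rw [hx]; ring
  have key := inner_grad_divFree hp hu
  have i : ∀ j, Integrable (fun x => w x * w' j x * u j x) volume := fun j => by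
    have := integrable_mul_L2 (u j) (hm j)
    simpa only [mul_comm] using this
  have e : ∀ j, inner ℝ ((hm j).toLp : L2) (u j) = ∫ x, w x * w' j x * u j x := fun j => by
    rw [real_inner_comm, inner_toLp_right]
    exact integral_congr_ae (Eventually.of_forall fun x => mul_comm _ _)
  simp_rw [e] at key
  rw [← integral_finsetSum _ (fun j _ => i j)] at key
  rw [← key]
  refine integral_congr_ae (Eventually.of_forall fun x => ?_)
  simp only [Finset.sum_mul]
  exact Finset.sum_congr rfl fun j _ => by ring

/-! ### Norms of absolutely continuous curves. -/

section Time

variable {H : Type*} [NormedAddCommGroup H] [InnerProductSpace ℝ H]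

lemma continuousOn_primitive {y : ℝ → H} {T : ℝ} (hy : IntervalIntegrable y volume 0 T) :
    ContinuousOn (fun t => ∫ s in 0..t, y s) (uIcc 0 T) :=
  intervalIntegral.continuousOn_primitive_interval' hy left_mem_uIcc

/-- The square of the norm of an absolutely continuous curve in a Hilbert space. -/
lemma norm_sq_primitive [CompleteSpace H] {y : ℝ → H} {T : ℝ} (hy : IntervalIntegrable y volume 0 T) :
    ‖∫ s in 0..T, y s‖ ^ 2 = ∫ t in 0..T, 2 * inner ℝ (∫ s in 0..t, y s) (y t) := by
  let X : ℝ → H := fun t => ∫ s in 0..t, y s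
  let F : ℝ → ℝ := fun t => ‖X t‖ ^ 2
  have hX : ContinuousOn X (uIcc 0 T) := continuousOn_primitive hy
  obtain ⟨M, hM⟩ := isCompact_uIcc.exists_bound_of_continuousOn hX
  have hN := hy.norm.absolutelyContinuousOnInterval_intervalIntegral (c := 0) left_mem_uIcc
  -- The increments of ‖X‖² are at most 2M times those of the scalar primitive of ‖y‖, which is
  -- absolutely continuous.
  have hF : AbsolutelyContinuousOnInterval F 0 T := by
    unfold AbsolutelyContinuousOnInterval at hN ⊢
    refine squeeze_zero' (Eventually.of_forall fun _ => Finset.sum_nonneg fun i _ => dist_nonneg) ?_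
      (by simpa using hN.const_mul (2 * M))
    rw [eventually_inf_principal]
    refine Eventually.of_forall fun E hE => ?_
    rw [Finset.mul_sum]
    refine Finset.sum_le_sum fun i hi => ?_
    obtain ⟨ha, hb⟩ := hE.1 i hi
    set a := (E.2 i).1
    set b := (E.2 i).2
    have hya : IntervalIntegrable y volume 0 a := hy.mono_set (uIcc_subset_uIcc left_mem_uIcc ha)
    have hyb : IntervalIntegrable y volume 0 b := hy.mono_set (uIcc_subset_uIcc left_mem_uIcc hb)
    have h1 : ‖X a - X b‖ ≤ dist (∫ s in 0..a, ‖y s‖) (∫ s in 0..b, ‖y s‖) := by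
      simp only [X]
      rw [intervalIntegral.integral_interval_sub_left hya hyb, Real.dist_eq,
        intervalIntegral.integral_interval_sub_left hya.norm hyb.norm]
      exact intervalIntegral.norm_integral_le_abs_integral_norm
    have h2 : |‖X a‖ - ‖X b‖| ≤ ‖X a - X b‖ := abs_norm_sub_norm_le _ _
    rw [Real.dist_eq]
    simp only [F]
    have h3 : ‖X a‖ ^ 2 - ‖X b‖ ^ 2 = (‖X a‖ + ‖X b‖) * (‖X a‖ - ‖X b‖) := by ring
    rw [h3, abs_mul, abs_of_nonneg (by positivity)]
    have := hM a ha
    have := hM b hb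
    exact mul_le_mul (by linarith) (h2.trans h1) (abs_nonneg _)
      (by linarith [norm_nonneg (X a)])
  have h0 : F 0 = 0 := by simp [F, X]
  have := hF.integral_deriv_eq_sub
  rw [h0, sub_zero] at this
  change F T = _
  rw [← this]
  refine intervalIntegral.integral_congr_ae ?_
  filter_upwards [hy.ae_hasDerivAt_integral] with t ht hmem
  have hd := ht (uIoc_subset_uIcc hmem) 0 left_mem_uIcc
  exact hd.norm_sq.deriv

lemma intervalIntegrable_inner_primitive {y : ℝ → H} {T : ℝ}
    (hy : IntervalIntegrable y volume 0 T) :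
    IntervalIntegrable (fun t => inner ℝ (∫ s in 0..t, y s) (y t)) volume 0 T := by
  have hX := continuousOn_primitive hy
  obtain ⟨M, hM⟩ := isCompact_uIcc.exists_bound_of_continuousOn hX
  rw [intervalIntegrable_iff] at hy ⊢
  have hXm : AEStronglyMeasurable (fun t => ∫ s in 0..t, y s) (volume.restrict (uIoc 0 T)) :=
    (hX.mono uIoc_subset_uIcc).aestronglyMeasurable measurableSet_uIoc
  refine (hy.norm.const_mul M).mono' (hXm.inner hy.aestronglyMeasurable) ?_
  filter_upwards [ae_restrict_mem measurableSet_uIoc] with t ht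
  exact (norm_inner_le_norm _ _).trans
    (mul_le_mul_of_nonneg_right (hM t (uIoc_subset_uIcc ht)) (norm_nonneg _))

end Time

lemma exists_ae_norm_le_of_memLp_top {α E : Type*} [MeasurableSpace α] {μ : Measure α}
    [NormedAddCommGroup E] {f : α → E} (hf : MemLp f ∞ μ) : ∃ M : ℝ, ∀ᵐ x ∂μ, ‖f x‖ ≤ M := by
  have h := hf.2
  rw [eLpNorm_exponent_top] at h
  refine ⟨(eLpNormEssSup f μ).toReal, ?_⟩
  filter_upwards [enorm_ae_le_eLpNormEssSup f μ] with x hx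
  rw [← toReal_enorm]
  exact ENNReal.toReal_mono h.ne hx

/-! ### Frequency truncation and the time derivative of ‖∂ⱼθ‖². -/

/-- The symbol of `∂ⱼ`, truncated to the frequencies `|ξ| ≤ n`. -/
def truncSymb (j : Fin 2) (n : ℕ) : Plane → ℂ := (Metric.closedBall 0 n).indicator (symb j)

lemma memLp_truncSymb (j : Fin 2) (n : ℕ) : MemLp (truncSymb j n) ∞ volume := by
  obtain ⟨C, hC⟩ := (isCompact_closedBall (0 : Plane) n).exists_bound_of_continuousOn
    (continuous_symb j).continuousOn
  refine memLp_top_of_bound ((continuous_symb j).aestronglyMeasurable.indicator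
    measurableSet_closedBall) (max C 0) (Eventually.of_forall fun ξ => ?_)
  unfold truncSymb
  by_cases h : ξ ∈ Metric.closedBall (0 : Plane) n
  · rw [indicator_of_mem h]; exact (hC ξ h).trans (le_max_left _ _)
  · rw [indicator_of_notMem h]; simp

/-- The derivative `∂ⱼ` truncated to the frequencies `|ξ| ≤ n`, on the Fourier side. -/
def truncD (j : Fin 2) (n : ℕ) : L2 →L[ℝ] Lp ℂ 2 (volume : Measure Plane) :=
  (((ContinuousLinearMap.mul ℝ ℂ).holderL volume ∞ 2 2) (memLp_truncSymb j n).toLp).comp fhat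

lemma coeFn_truncD (j : Fin 2) (n : ℕ) (f : L2) :
    truncD j n f =ᵐ[volume] fun ξ => truncSymb j n ξ * fhat f ξ := by
  have h := (ContinuousLinearMap.mul ℝ ℂ).coeFn_holder (r := 2) (memLp_truncSymb j n).toLp (fhat f)
  filter_upwards [h, (memLp_truncSymb j n).coeFn_toLp] with ξ h1 h2
  rw [h2] at h1
  exact h1

lemma tendsto_indicator_closedBall {E : Type*} [AddCommGroup E] [TopologicalSpace E]
    (F : Plane → E) (ξ : Plane) :
    Tendsto (fun n : ℕ => (Metric.closedBall (0 : Plane) n).indicator F ξ) atTop (𝓝 (F ξ)) := by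
  refine tendsto_const_nhds.congr' ?_
  filter_upwards [eventually_ge_atTop ⌈‖ξ‖⌉₊] with n hn
  rw [indicator_of_mem]
  simpa using Nat.ceil_le.mp hn

/-- Both symbols are moved onto the first factor, so g, which will be θₜ, needs no derivative. -/
lemma inner_truncD {j : Fin 2} (n : ℕ) {f f' f'' : L2} (h : IsWeakPartial j f f')
    (h' : IsWeakPartial j f' f'') (g : L2) :
    inner ℝ (truncD j n f) (truncD j n g)
      = - ∫ ξ, (Metric.closedBall (0 : Plane) n).indicator
          (fun ξ => inner ℝ (fhat f'' ξ) (fhat g ξ)) ξ := by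
  rw [L2.inner_def, ← integral_neg]
  refine integral_congr_ae ?_
  filter_upwards [coeFn_truncD j n f, coeFn_truncD j n g, fhat_weakPartial h,
    fhat_weakPartial h'] with ξ a b c d
  rw [a, b]
  unfold truncSymb
  by_cases hξ : ξ ∈ Metric.closedBall (0 : Plane) n
  · rw [indicator_of_mem hξ, indicator_of_mem hξ, d, c, Complex.inner, Complex.inner,
      ← Complex.neg_re]
    simp only [map_mul, conj_symb]
    congr 1; ring
  · rw [indicator_of_notMem hξ, indicator_of_notMem hξ]; simp

/-- Uniformity in n is the point: this is the domination for the time integrals. -/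
lemma abs_inner_truncD_le {j : Fin 2} (n : ℕ) {f f' f'' : L2} (h : IsWeakPartial j f f')
    (h' : IsWeakPartial j f' f'') (g : L2) :
    |inner ℝ (truncD j n f) (truncD j n g)| ≤ ‖f''‖ * ‖g‖ := by
  rw [inner_truncD n h h' g, abs_neg, integral_indicator measurableSet_closedBall]
  have hi : Integrable (fun ξ => ‖fhat f'' ξ‖ * ‖fhat g ξ‖) volume :=
    (Lp.memLp (fhat f'')).norm.integrable_mul (Lp.memLp (fhat g)).norm
  calc |∫ ξ in Metric.closedBall (0 : Plane) n, inner ℝ (fhat f'' ξ) (fhat g ξ)|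
      ≤ ∫ ξ in Metric.closedBall (0 : Plane) n, ‖fhat f'' ξ‖ * ‖fhat g ξ‖ :=
        by
        rw [← Real.norm_eq_abs]
        exact norm_integral_le_of_norm_le hi.integrableOn
          (Eventually.of_forall fun ξ => norm_inner_le_norm _ _)
    _ ≤ ∫ ξ, ‖fhat f'' ξ‖ * ‖fhat g ξ‖ :=
        setIntegral_le_integral hi (Eventually.of_forall fun ξ => by positivity)
    _ ≤ ‖f''‖ * ‖g‖ := by
        have hf := (Lp.memLp (fhat f'')).norm
        have hg := (Lp.memLp (fhat g)).norm
        have e := real_inner_le_norm (hf.toLp : L2) hg.toLp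
        rw [inner_toLp_right, Lp.norm_toLp, Lp.norm_toLp, eLpNorm_norm, eLpNorm_norm,
          ← Lp.norm_def, ← Lp.norm_def, norm_fhat, norm_fhat] at e
        refine le_trans (le_of_eq (integral_congr_ae ?_)) e
        filter_upwards [hf.coeFn_toLp] with x hx
        rw [hx]

lemma tendsto_inner_truncD {j : Fin 2} {f f' f'' : L2} (h : IsWeakPartial j f f')
    (h' : IsWeakPartial j f' f'') (g : L2) :
    Tendsto (fun n => inner ℝ (truncD j n f) (truncD j n g)) atTop (𝓝 (- inner ℝ f'' g)) := by
  simp_rw [inner_truncD _ h h' g]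
  refine Tendsto.neg ?_
  rw [← inner_fhat, L2.inner_def]
  have hi := L2.integrable_inner (𝕜 := ℝ) (fhat f'') (fhat g)
  refine tendsto_integral_of_dominated_convergence (fun ξ => ‖inner ℝ (fhat f'' ξ) (fhat g ξ)‖)
    (fun n => hi.aestronglyMeasurable.indicator measurableSet_closedBall) hi.norm
    (fun n => Eventually.of_forall fun ξ => norm_indicator_le_norm_self _ _)
    (Eventually.of_forall fun ξ => tendsto_indicator_closedBall _ ξ)

/-- If the truncated derivatives of `f` have convergent norms, then `∂ⱼ f` exists in `L²`. -/
lemma exists_weakPartial_of_tendsto {j : Fin 2} {f : L2} {R : ℝ}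
    (h : Tendsto (fun n => ‖truncD j n f‖ ^ 2) atTop (𝓝 R)) :
    ∃ g : L2, IsWeakPartial j f g ∧ ‖g‖ ^ 2 = R := by
  obtain ⟨M, hM⟩ := h.bddAbove_range
  have hM' : ∀ n, ‖truncD j n f‖ ≤ √M := fun n =>
    Real.le_sqrt_of_sq_le (hM (mem_range_self n))
  have hmem : MemLp (fun ξ => symb j ξ * fhat f ξ) 2 volume := by
    refine ⟨(continuous_symb j).aestronglyMeasurable.mul (Lp.aestronglyMeasurable _), ?_⟩
    -- Fatou's lemma: the truncated symbols converge pointwise and the norms stay bounded, so the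
    -- full product is in L².
    have hlim := Lp.eLpNorm_lim_le_liminf_eLpNorm (p := 2) (μ := volume)
      (f := fun n ξ => truncSymb j n ξ * fhat f ξ)
      (fun n => (memLp_truncSymb j n).aestronglyMeasurable.mul (Lp.aestronglyMeasurable _))
      (fun ξ => symb j ξ * fhat f ξ)
      (Eventually.of_forall fun ξ => (tendsto_indicator_closedBall (symb j) ξ).mul_const _)
    refine hlim.trans_lt (lt_of_le_of_lt ?_ (ENNReal.ofReal_lt_top (r := √M)))
    refine liminf_le_of_frequently_le' (Frequently.of_forall fun n => ?_)
    rw [← eLpNorm_congr_ae (coeFn_truncD j n f), ← Lp.enorm_def, ← ofReal_norm]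
    exact ENNReal.ofReal_le_ofReal (hM' n)
  obtain ⟨g, hg⟩ := exists_weakPartial (G := hmem.toLp) hmem.coeFn_toLp
  refine ⟨g, hg, tendsto_nhds_unique ?_ h⟩
  have e1 : ∀ F : Lp ℂ 2 (volume : Measure Plane), ‖F‖ ^ 2 = ∫ ξ, ‖F ξ‖ ^ 2 := fun F => by
    rw [← real_inner_self_eq_norm_sq, L2.inner_def]
    exact integral_congr_ae (Eventually.of_forall fun ξ => real_inner_self_eq_norm_sq _)
  have hi : Integrable (fun ξ => ‖fhat g ξ‖ ^ 2) volume :=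
    (Lp.memLp (fhat g)).norm.integrable_sq
  have e2 : ∀ n, ‖truncD j n f‖ ^ 2
      = ∫ ξ, (Metric.closedBall (0 : Plane) n).indicator (fun ξ => ‖fhat g ξ‖ ^ 2) ξ := fun n => by
    rw [e1]
    refine integral_congr_ae ?_
    filter_upwards [coeFn_truncD j n f, fhat_weakPartial hg] with ξ a b
    rw [a]
    unfold truncSymb
    by_cases hξ : ξ ∈ Metric.closedBall (0 : Plane) n
    · rw [indicator_of_mem hξ, indicator_of_mem hξ, b]
    · rw [indicator_of_notMem hξ, indicator_of_notMem hξ]; simp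
  simp_rw [e2]
  rw [← norm_fhat, e1]
  refine tendsto_integral_of_dominated_convergence (fun ξ => ‖fhat g ξ‖ ^ 2)
    (fun n => hi.aestronglyMeasurable.indicator measurableSet_closedBall) hi
    (fun n => Eventually.of_forall fun ξ => ?_)
    (Eventually.of_forall fun ξ => tendsto_indicator_closedBall _ ξ)
  refine (norm_indicator_le_norm_self _ _).trans (le_of_eq ?_)
  simp

/-- A curve in `W^{1,1}(0, T; L²)` starting at `0` whose second derivative `∂ⱼ²` is bounded in `L²`
takes values in the domain of `∂ⱼ`, and the norm of this derivative is absolutely continuous. -/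
lemma norm_sq_weakPartial_curve {T : ℝ} (hT : 0 ≤ T) {θ θ' L : ℝ → L2} {j : Fin 2}
    (hθ : IsTimeDeriv T θ θ') (h0 : θ 0 = 0)
    (hL : ∀ᵐ s ∂volume.restrict (Ioo 0 T), ∃ g : L2,
      IsWeakPartial j (θ s) g ∧ IsWeakPartial j g (L s))
    (hLm : MemLp L ∞ (volume.restrict (Ioo 0 T))) :
    IntervalIntegrable (fun s => inner ℝ (L s) (θ' s)) volume 0 T ∧
    ∀ t ∈ Icc 0 T, ∃ g : L2, IsWeakPartial j (θ t) g ∧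
      ‖g‖ ^ 2 = ∫ s in 0..t, -2 * inner ℝ (L s) (θ' s) := by
  obtain ⟨hint, hprim⟩ := hθ
  simp only [h0, zero_add] at hprim
  rw [Measure.restrict_congr_set Ioo_ae_eq_Ioc] at hL hLm
  have hint' : IntegrableOn θ' (Ioc 0 T) volume := by
    rwa [intervalIntegrable_iff_integrableOn_Ioc_of_le hT] at hint
  obtain ⟨M, hM⟩ : ∃ M : ℝ, ∀ᵐ s ∂volume.restrict (Ioc 0 T), ‖L s‖ ≤ M :=
    exists_ae_norm_le_of_memLp_top hLm
  refine ⟨?_, fun t ht => ?_⟩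
  · rw [intervalIntegrable_iff_integrableOn_Ioc_of_le hT]
    refine (hint'.norm.const_mul M).mono' (hLm.aestronglyMeasurable.inner hint'.aestronglyMeasurable)
      ?_
    filter_upwards [hM] with s hs
    exact (norm_inner_le_norm _ _).trans (mul_le_mul_of_nonneg_right hs (norm_nonneg _))
  · have hsub : uIcc 0 t ⊆ uIcc 0 T := by
      rw [uIcc_of_le ht.1, uIcc_of_le hT]; exact Icc_subset_Icc le_rfl ht.2
    have hintt := hint.mono_set hsub
    have hsubc : Ioc 0 t ⊆ Ioc 0 T := Ioc_subset_Ioc le_rfl ht.2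
    apply exists_weakPartial_of_tendsto
    -- The truncated derivative is a bounded operator, so it commutes with the time integral and the
    -- formula for the squared norm applies at each n.
    have e : ∀ n, ‖truncD j n (θ t)‖ ^ 2
        = ∫ s in 0..t, 2 * inner ℝ (truncD j n (θ s)) (truncD j n (θ' s)) := fun n => by
      have hi : IntervalIntegrable (fun s => truncD j n (θ' s)) volume 0 t := by
        rw [intervalIntegrable_iff] at hintt ⊢
        exact (truncD j n).integrable_comp hintt
      rw [hprim t ht, ← ContinuousLinearMap.intervalIntegral_comp_comm _ hintt,
        norm_sq_primitive hi]
      refine intervalIntegral.integral_congr fun s hs => ?_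
      have hs' : s ∈ Icc 0 T := by rw [uIcc_of_le ht.1] at hs; exact ⟨hs.1, hs.2.trans ht.2⟩
      rw [ContinuousLinearMap.intervalIntegral_comp_comm, ← hprim s hs']
      refine hint.mono_set ?_
      rw [uIcc_of_le hs'.1, uIcc_of_le hT]; exact Icc_subset_Icc le_rfl hs'.2
    simp_rw [e]
    have hθc : ContinuousOn θ (uIcc 0 t) := by
      refine ((continuousOn_primitive hint).mono hsub).congr fun s hs => hprim s ?_
      have := hsub hs
      rwa [uIcc_of_le hT] at this
    have hθm : AEStronglyMeasurable θ (volume.restrict (uIoc 0 t)) :=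
      (hθc.mono uIoc_subset_uIcc).aestronglyMeasurable measurableSet_uIoc
    rw [intervalIntegrable_iff] at hintt
    have key : ∀ᵐ s, s ∈ uIoc 0 t → (‖L s‖ ≤ M ∧ ∃ g : L2,
      IsWeakPartial j (θ s) g ∧ IsWeakPartial j g (L s)) := by
      rw [uIoc_of_le ht.1, ← ae_restrict_iff' measurableSet_Ioc]
      exact ae_restrict_of_ae_restrict_of_subset hsubc (hM.and hL)
    refine intervalIntegral.tendsto_integral_filter_of_dominated_convergence
      (fun s => 2 * (M * ‖θ' s‖)) (Eventually.of_forall fun n => ?_)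
      (Eventually.of_forall fun n => ?_) ?_ ?_
    · exact (((truncD j n).continuous.comp_aestronglyMeasurable hθm).inner
        ((truncD j n).continuous.comp_aestronglyMeasurable hintt.aestronglyMeasurable)).const_mul _
    · filter_upwards [key] with s hs hmem
      obtain ⟨h1, g, hg, hg'⟩ := hs hmem
      rw [norm_mul, Real.norm_two]
      refine mul_le_mul_of_nonneg_left ?_ zero_le_two
      exact (abs_inner_truncD_le n hg hg' _).trans
        (mul_le_mul_of_nonneg_right h1 (norm_nonneg _))
    · rw [intervalIntegrable_iff]
      exact (hintt.norm.const_mul M).const_mul 2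
    · filter_upwards [key] with s hs hmem
      obtain ⟨h1, g, hg, hg'⟩ := hs hmem
      have := (tendsto_inner_truncD hg hg' (θ' s)).const_mul 2
      rwa [show (2:ℝ) * -inner ℝ (L s) (θ' s) = -2 * inner ℝ (L s) (θ' s) by ring] at this

/-! ### Sobolev classes and the total pressure. -/

lemma MemH.isWeakPartial {k : ℕ} {f : L2} (h : MemH (k + 1) f) (j : Fin 2) :
    IsWeakPartial j f (weakD j f) := by
  obtain ⟨g, hg, -⟩ := h j
  rwa [weakD_eq hg]

lemma MemH.weakD {k : ℕ} {f : L2} (h : MemH (k + 1) f) (j : Fin 2) : MemH k (weakD j f) := by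
  obtain ⟨g, hg, hk⟩ := h j
  rwa [weakD_eq hg]

lemma MemH.of_succ : ∀ {k : ℕ} {f : L2}, MemH (k + 1) f → MemH k f
  | 0, _, _ => trivial
  | _ + 1, _, h => fun j => by
    obtain ⟨g, hg, hk⟩ := h j
    exact ⟨g, hg, hk.of_succ⟩

lemma MemH.mono {k l : ℕ} (hkl : k ≤ l) {f : L2} (h : MemH l f) : MemH k f := by
  induction hkl with
  | refl => exact h
  | step _ ih => exact ih h.of_succ

lemma weakD_comm {f : L2} (h : MemH 2 f) (i j : Fin 2) :
    weakD i (weakD j f) = weakD j (weakD i f) := by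
  have h1 := fhat_weakPartial ((h.weakD j).isWeakPartial i)
  have h2 := fhat_weakPartial ((h.weakD i).isWeakPartial j)
  have h3 := fhat_weakPartial (h.isWeakPartial i)
  have h4 := fhat_weakPartial (h.isWeakPartial j)
  have e : fhat (weakD i (weakD j f)) = fhat (weakD j (weakD i f)) := by
    refine Lp.ext ?_
    filter_upwards [h1, h2, h3, h4] with ξ a b c d
    rw [a, b, c, d]; ring
  rw [← sub_eq_zero, ← norm_eq_zero, ← norm_fhat, map_sub, e, sub_self, norm_zero]

/-- Used only to make products integrable; this bound never enters a constant. -/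
lemma MemH.exists_bound {f : L2} (h : MemH 2 f) : ∃ B : ℝ, ∀ᵐ x, |f x| ≤ B := by
  obtain ⟨C, -, hC⟩ := exists_sobolev_const
  exact ⟨_, hC f (fun j => MHD.weakD j f) (fun j => MHD.weakD j (MHD.weakD j f))
    (fun j => h.isWeakPartial j) (fun j => (h.weakD j).isWeakPartial j)⟩

lemma isWeakPartial_sum {j : Fin 2} {F G : Fin 2 → Plane → ℝ}
    (h : ∀ i, IsWeakPartial j (F i) (G i)) :
    IsWeakPartial j (fun x => ∑ i, F i x) (fun x => ∑ i, G i x) := by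
  simp only [Fin.sum_univ_two]
  exact (h 0).add (h 1)

/-- The momentum equation with the magnetic pressure absorbed in the pressure, whose gradient is
then in `L²`. -/
lemma Momentum.exists_total_pressure {ν S : ℝ} {u ut : Fin 2 → L2} {φ : L2}
    (h : Momentum ν S u ut φ) (hu : ∀ i, MemH 2 (u i)) (hφ : MemH 3 φ) :
    ∃ (P : Plane → ℝ) (Q : Fin 2 → L2), (∀ i, IsWeakPartial i P (Q i)) ∧
      ∀ i, ∀ᵐ x, ut i x = - Q i x - ∑ j, u j x * weakD j (u i) x
        + ν * ∑ j, weakD j (weakD j (u i)) x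
        - S * (weakD i φ x * ∑ j, weakD j (weakD j φ) x) := by
  obtain ⟨p, G, τ, hG, hτ, heq⟩ := h
  have hφ2 : MemH 2 φ := hφ.of_succ
  -- From ∇·(∇φ⊗∇φ) = ∇φ Δφ + ∇|∇φ|²/2.
  let P : Plane → ℝ := fun x => p x + (S / 2) * ∑ j, weakD j φ x * weakD j φ x
  let Q : Fin 2 → Plane → ℝ := fun i x =>
    G i x + (S / 2) * ∑ j, (weakD i (weakD j φ) x * weakD j φ x + weakD j φ x * weakD i (weakD j φ) x)
  have hPQ : ∀ i, IsWeakPartial i P (Q i) := fun i =>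
    (hG i).add ((isWeakPartial_sum fun j => ((hφ.weakD j).isWeakPartial i).mul
      ((hφ.weakD j).isWeakPartial i)).const_mul (S / 2))
  -- The equation solved for the total pressure gradient; every term is in L² because u and ∇φ are
  -- bounded.
  let R : Fin 2 → Plane → ℝ := fun i x => - ut i x - ∑ j, u j x * weakD j (u i) x
        + ν * ∑ j, weakD j (weakD j (u i)) x
        - S * (weakD i φ x * ∑ j, weakD j (weakD j φ) x)
  have hR : ∀ i, MemLp (R i) 2 volume := fun i => by
    have a : ∀ j, MemLp (fun x => u j x * weakD j (u i) x) 2 volume := fun j => by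
      obtain ⟨B, hB⟩ := (hu j).exists_bound
      exact memLp_bdd_mul _ _ hB
    obtain ⟨B, hB⟩ := (hφ.weakD i).exists_bound
    have b : ∀ j, MemLp (fun x => weakD i φ x * weakD j (weakD j φ) x) 2 volume := fun j =>
      memLp_bdd_mul _ _ hB
    have := ((((Lp.memLp (ut i)).neg.sub (memLp_finsetSum Finset.univ fun j _ => a j))).add
      ((memLp_finsetSum Finset.univ fun j _ => Lp.memLp (weakD j (weakD j (u i)))).const_mul
        ν)).sub ((memLp_finsetSum Finset.univ fun j _ => b j).const_mul S)
    refine this.ae_eq (Eventually.of_forall fun x => ?_)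
    simp [R, mul_add]
  have hQR : ∀ i, Q i =ᵐ[volume] R i := fun i => by
    have ht : ∀ j, τ i j =ᵐ[volume] fun x => weakD j (weakD i φ) x * weakD j φ x
        + weakD i φ x * weakD j (weakD j φ) x := fun j =>
      (hτ i j).ae_eq (((hφ.weakD i).isWeakPartial j).mul ((hφ.weakD j).isWeakPartial j))
    filter_upwards [heq i, ht 0, ht 1] with x h1 h2 h3
    simp only [Q, R]
    simp only [Fin.sum_univ_two] at h1 ⊢
    rw [h2, h3] at h1
    rw [weakD_comm hφ2 i 0, weakD_comm hφ2 i 1]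
    linarith
  refine ⟨P, fun i => (hR i).toLp, fun i => (hPQ i).congr (ae_eq_refl _)
    ((hQR i).trans (hR i).coeFn_toLp.symm), fun i => ?_⟩
  filter_upwards [(hR i).coeFn_toLp] with x hx
  rw [hx]
  simp only [R]
  ring

/-! ### The energy inequality at a fixed time. -/

/-- The pointwise quadratic estimate behind the energy inequality for the difference of two
solutions. -/
lemma quadratic_estimate {B S η : ℝ} (hB : 0 ≤ B) (hS : 0 < S) (hη : 0 < η)
    {w v ψ' θ' : Fin 2 → ℝ} {dv : Fin 2 → Fin 2 → ℝ} {θ Lθ Lψ : ℝ}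
    (hv : ∀ i, |v i| ≤ B) (hdv : ∀ i j, |dv i j| ≤ B) (hψ' : ∀ i, |ψ' i| ≤ B) (hLψ : |Lψ| ≤ B) :
    - (∑ i, ∑ j, w j * w i * dv i j) - S * Lψ * ∑ i, θ' i * w i + S * Lθ * ∑ j, v j * θ' j
        - S * η * Lθ ^ 2 - θ * ∑ j, w j * ψ' j
      ≤ (3 * B + S * B + B ^ 2 / (2 * η)) * (∑ i, w i ^ 2 + θ ^ 2 + S * ∑ j, θ' j ^ 2) := by
  have young : ∀ {a c d : ℝ}, |a| ≤ B → a * (c * d) ≤ B * ((c ^ 2 + d ^ 2) / 2) := by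
    intro a c d ha
    calc a * (c * d) ≤ |a * (c * d)| := le_abs_self _
      _ = |a| * |c * d| := abs_mul _ _
      _ ≤ B * ((c ^ 2 + d ^ 2) / 2) := by
        refine mul_le_mul ha ?_ (abs_nonneg _) hB
        rw [abs_mul]
        nlinarith [sq_nonneg (|c| - |d|), sq_abs c, sq_abs d]
  have young' : ∀ {a c d : ℝ}, |a| ≤ B → -(a * (c * d)) ≤ B * ((c ^ 2 + d ^ 2) / 2) := by
    intro a c d ha
    have := young (a := -a) (c := c) (d := d) (by rwa [abs_neg])
    linarith
  have t1 : - (∑ i, ∑ j, w j * w i * dv i j) ≤ 2 * B * ∑ i, w i ^ 2 := by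
    simp only [Fin.sum_univ_two]
    have a := young' (c := w 0) (d := w 0) (hdv 0 0)
    have b := young' (c := w 1) (d := w 0) (hdv 0 1)
    have c := young' (c := w 0) (d := w 1) (hdv 1 0)
    have d := young' (c := w 1) (d := w 1) (hdv 1 1)
    linarith
  have t2 : - (S * Lψ * ∑ i, θ' i * w i) ≤ S * (B / 2 * (∑ i, w i ^ 2 + ∑ j, θ' j ^ 2)) := by
    have a := young' (c := θ' 0) (d := w 0) hLψ
    have b := young' (c := θ' 1) (d := w 1) hLψ
    have : -(Lψ * ∑ i, θ' i * w i) ≤ B / 2 * (∑ i, w i ^ 2 + ∑ j, θ' j ^ 2) := by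
      simp only [Fin.sum_univ_two]; linarith
    calc _ = S * -(Lψ * ∑ i, θ' i * w i) := by ring
      _ ≤ _ := mul_le_mul_of_nonneg_left this hS.le
  -- The factor Δθ is not controlled by the energy; completing the square against -Sη|Δθ|² removes
  -- it and produces B²/(2η).
  have t3 : S * Lθ * ∑ j, v j * θ' j - S * η * Lθ ^ 2
      ≤ S * (B ^ 2 / (2 * η) * ∑ j, θ' j ^ 2) := by
    set X := ∑ j, v j * θ' j with hX
    have hX2 : X ^ 2 ≤ 2 * B ^ 2 * ∑ j, θ' j ^ 2 := by
      have hsq : ∀ i, v i ^ 2 ≤ B ^ 2 := fun i => sq_le_sq' (abs_le.mp (hv i)).1 (abs_le.mp (hv i)).2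
      have h1 : X ^ 2 ≤ (∑ j, v j ^ 2) * ∑ j, θ' j ^ 2 := Finset.sum_mul_sq_le_sq_mul_sq _ _ _
      refine h1.trans (mul_le_mul_of_nonneg_right ?_ (Finset.sum_nonneg fun i _ => sq_nonneg _))
      rw [Fin.sum_univ_two]; linarith [hsq 0, hsq 1]
    have h2 : Lθ * X - η * Lθ ^ 2 ≤ X ^ 2 / (4 * η) := by
      rw [le_div_iff₀ (by positivity)]
      nlinarith [sq_nonneg (X - 2 * η * Lθ)]
    have h3 : X ^ 2 / (4 * η) ≤ B ^ 2 / (2 * η) * ∑ j, θ' j ^ 2 := by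
      calc X ^ 2 / (4 * η) ≤ (2 * B ^ 2 * ∑ j, θ' j ^ 2) / (4 * η) := by gcongr
        _ = _ := by field_simp; ring
    calc _ = S * (Lθ * X - η * Lθ ^ 2) := by ring
      _ ≤ _ := mul_le_mul_of_nonneg_left (h2.trans h3) hS.le
  have t4 : - (θ * ∑ j, w j * ψ' j) ≤ B * (θ ^ 2 + ∑ i, w i ^ 2) := by
    simp only [Fin.sum_univ_two]
    have a := young' (c := θ) (d := w 0) (hψ' 0)
    have b := young' (c := θ) (d := w 1) (hψ' 1)
    nlinarith [mul_nonneg hB (sq_nonneg (w 0)), mul_nonneg hB (sq_nonneg (w 1))]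
  have nw : 0 ≤ ∑ i, w i ^ 2 := Finset.sum_nonneg fun i _ => sq_nonneg _
  have nθ : 0 ≤ ∑ j, θ' j ^ 2 := Finset.sum_nonneg fun i _ => sq_nonneg _
  generalize ∑ i, w i ^ 2 = W at *
  generalize ∑ j, θ' j ^ 2 = Θ at *
  have hK : 0 ≤ B ^ 2 / (2 * η) := by positivity
  generalize B ^ 2 / (2 * η) = K at *
  have p1 := mul_nonneg hB nw
  have p2 := mul_nonneg hS.le p1
  have p3 := mul_nonneg hK nw
  have p4 := mul_nonneg hB (sq_nonneg θ)
  have p5 := mul_nonneg hS.le p4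
  have p6 := mul_nonneg hK (sq_nonneg θ)
  have p7 := mul_nonneg hS.le (mul_nonneg hB nθ)
  have p8 := mul_nonneg hS.le p7
  nlinarith

lemma norm_sq_L2_eq (f : L2) : ‖f‖ ^ 2 = ∫ x, f x ^ 2 := by
  rw [← real_inner_self_eq_norm_sq, inner_L2_eq]
  exact integral_congr_ae (Eventually.of_forall fun x => (sq _).symm)

lemma integrable_sq_L2 (f : L2) : Integrable (fun x => f x ^ 2) volume := (Lp.memLp f).integrable_sq

/-- The viscous term in the energy inequality for the difference of two velocities. -/
lemma viscous_term_le {ν : ℝ} (hν : 0 ≤ ν) {u v : L2} (hu : MemH 2 u) (hv : MemH 1 v) :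
    ν * ∑ j, inner ℝ (weakD j (weakD j u)) (u - v) ≤ ν / 4 * ∑ j, ‖weakD j v‖ ^ 2 := by
  have h : ∀ j, inner ℝ (weakD j (weakD j u)) (u - v) ≤ 1 / 4 * ‖weakD j v‖ ^ 2 := fun j => by
    rw [inner_weakPartial ((hu.weakD j).isWeakPartial j)
      ((hu.isWeakPartial j).sub_L2 (hv.isWeakPartial j))]
    -- With a = ∂ⱼu and b = ∂ⱼv, expanding |a - b/2|² ≥ 0 gives -⟨a, a - b⟩ ≤ |b|²/4, so no bound on
    -- ∇u remains.
    have := sq_nonneg ‖weakD j u - (1 / 2 : ℝ) • weakD j v‖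
    rw [inner_sub_right, real_inner_self_eq_norm_sq]
    have h1 := norm_sub_sq_real (weakD j u) ((1 / 2 : ℝ) • weakD j v)
    rw [inner_smul_right, norm_smul, mul_pow] at h1
    norm_num at h1
    linarith
  calc _ ≤ ν * ∑ j, 1 / 4 * ‖weakD j v‖ ^ 2 :=
        mul_le_mul_of_nonneg_left (Finset.sum_le_sum fun j _ => h j) hν
    _ = _ := by rw [← Finset.mul_sum]; ring

/-- The energy inequality at a fixed time for the difference of a viscous and an inviscid
solution. -/
lemma energy_inequality {ν η S B : ℝ} (hν : 0 ≤ ν) (hη : 0 < η) (hS : 0 < S) (hB : 0 ≤ B)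
    {u ut v vt : Fin 2 → L2} {φ φt ψ ψt : L2}
    (hu : ∀ i, MemH 2 (u i)) (hv : ∀ i, MemH 2 (v i)) (hφ : MemH 3 φ) (hψ : MemH 3 ψ)
    (hdu : DivFree u) (hdv : DivFree v)
    (hmu : Momentum ν S u ut φ) (hmv : Momentum 0 S v vt ψ)
    (hfφ : Flux η u φ φt) (hfψ : Flux η v ψ ψt)
    (bv : ∀ i, ∀ᵐ x, |v i x| ≤ B) (bdv : ∀ i j, ∀ᵐ x, |weakD j (v i) x| ≤ B)
    (bψ : ∀ i, ∀ᵐ x, |weakD i ψ x| ≤ B) (bLψ : ∀ᵐ x, |∑ j, weakD j (weakD j ψ) x| ≤ B) :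
    ∑ i, inner ℝ (u i - v i) (ut i - vt i) + inner ℝ (φ - ψ) (φt - ψt)
        - S * ∑ j, inner ℝ (weakD j (weakD j φ) - weakD j (weakD j ψ)) (φt - ψt)
      ≤ (3 * B + S * B + B ^ 2 / (2 * η)) * (∑ i, ‖u i - v i‖ ^ 2 + ‖φ - ψ‖ ^ 2
          + S * ∑ j, ‖weakD j φ - weakD j ψ‖ ^ 2)
        + ν / 4 * ∑ i, ∑ j, ‖weakD j (v i)‖ ^ 2 := by
  set K := 3 * B + S * B + B ^ 2 / (2 * η)
  obtain ⟨P, Q, hPQ, hQ⟩ := hmu.exists_total_pressure hu hφ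
  obtain ⟨P', Q', hPQ', hQ'⟩ := hmv.exists_total_pressure hv hψ
  let w : Fin 2 → L2 := fun i => u i - v i
  let wt : Fin 2 → L2 := fun i => ut i - vt i
  let dw : Fin 2 → Fin 2 → L2 := fun i j => weakD j (u i) - weakD j (v i)
  let q : Fin 2 → L2 := fun i => Q i - Q' i
  let θ : L2 := φ - ψ
  let θt : L2 := φt - ψt
  let dθ : Fin 2 → L2 := fun j => weakD j φ - weakD j ψ
  let ddθ : Fin 2 → L2 := fun j => weakD j (weakD j φ) - weakD j (weakD j ψ)
  have hw : ∀ i j, IsWeakPartial j (w i) (dw i j) := fun i j =>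
    ((hu i).isWeakPartial j).sub_L2 ((hv i).isWeakPartial j)
  have hθ : ∀ j, IsWeakPartial j θ (dθ j) := fun j =>
    (hφ.isWeakPartial j).sub_L2 (hψ.isWeakPartial j)
  have hθ' : ∀ j, IsWeakPartial j (dθ j) (ddθ j) := fun j =>
    ((hφ.weakD j).isWeakPartial j).sub_L2 ((hψ.weakD j).isWeakPartial j)
  have hdw : DivFree w := fun χ hχ hc => by
    have h1 := hdu χ hχ hc
    have h2 := hdv χ hχ hc
    have e : ∀ i, ∫ x, w i x * partialD i χ x
        = (∫ x, u i x * partialD i χ x) - ∫ x, v i x * partialD i χ x := fun i => by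
      have hm := memLp_test (continuous_partialD (j := i) hχ) (hasCompactSupport_partialD hc) 2
      rw [← integral_sub (integrable_mul_L2 _ hm) (integrable_mul_L2 _ hm)]
      refine integral_congr_ae ?_
      filter_upwards [Lp.coeFn_sub (u i) (v i)] with x hx
      simp only [w]
      rw [hx, Pi.sub_apply]; ring
    simp_rw [e, Finset.sum_sub_distrib, h1, h2, sub_zero]
  -- These bounds on u, w and θ are existential on purpose: they justify integrability and do not
  -- reach the final constant.
  have bu : ∀ j, ∃ C, ∀ᵐ x, |u j x| ≤ C := fun j => (hu j).exists_bound
  have bw : ∀ j, ∃ C, ∀ᵐ x, |w j x| ≤ C := fun j => by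
    obtain ⟨C, hC⟩ := bu j
    refine ⟨C + B, ?_⟩
    filter_upwards [hC, bv j, Lp.coeFn_sub (u j) (v j)] with x h1 h2 h3
    simp only [w]; rw [h3, Pi.sub_apply]
    exact (abs_sub _ _).trans (add_le_add h1 h2)
  have bθ : ∃ C, ∀ᵐ x, |θ x| ≤ C := by
    obtain ⟨C, hC⟩ := (hφ.of_succ).exists_bound
    obtain ⟨C', hC'⟩ := (hψ.of_succ).exists_bound
    refine ⟨C + C', ?_⟩
    filter_upwards [hC, hC', Lp.coeFn_sub φ ψ] with x h1 h2 h3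
    simp only [θ]; rw [h3, Pi.sub_apply]
    exact (abs_sub _ _).trans (add_le_add h1 h2)
  have I1 : ∑ i, ∫ x, q i x * w i x = 0 := by
    have := inner_grad_divFree (G := q) (fun i =>
      ((hPQ i).sub (hPQ' i)).congr (ae_eq_refl _) (Lp.coeFn_sub (Q i) (Q' i)).symm) hdw
    simpa only [inner_L2_eq] using this
  have I2 : ∀ i, ∫ x, (∑ j, u j x * dw i j x) * w i x = 0 := fun i => by
    obtain ⟨C, hC⟩ := bw i
    exact integral_transport_eq_zero hdu (hw i) hC
  have I3 : ∫ x, (∑ j, u j x * dθ j x) * θ x = 0 := by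
    obtain ⟨C, hC⟩ := bθ
    exact integral_transport_eq_zero hdu hθ hC
  have I4 : ∀ i, ν * ∑ j, ∫ x, weakD j (weakD j (u i)) x * w i x
      ≤ ν / 4 * ∑ j, ‖weakD j (v i)‖ ^ 2 := fun i => by
    simpa only [inner_L2_eq] using viscous_term_le hν (hu i) (hv i).of_succ
  have I5 : η * ∑ j, ∫ x, ddθ j x * θ x ≤ 0 := by
    refine mul_nonpos_of_nonneg_of_nonpos hη.le (Finset.sum_nonpos fun j _ => ?_)
    rw [← inner_L2_eq, inner_weakPartial (hθ' j) (hθ j), real_inner_self_eq_norm_sq]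
    exact neg_nonpos.mpr (sq_nonneg _)
  have J1 : ∀ i, Integrable (fun x => q i x * w i x) volume := fun i => integrable_L2_mul _ _
  have Jt : ∀ (f : Fin 2 → L2) (g : L2),
      Integrable (fun x => (∑ j, u j x * f j x) * g x) volume := fun f g => by
    simp_rw [Finset.sum_mul]
    refine integrable_finsetSum _ fun j _ => ?_
    obtain ⟨C, hC⟩ := bu j
    exact (memLp_bdd_mul (u j) (f j) hC).integrable_mul (Lp.memLp g)
  have J4 : ∀ i j, Integrable (fun x => weakD j (weakD j (u i)) x * w i x) volume :=
    fun i j => integrable_L2_mul _ _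
  have J5 : ∀ j, Integrable (fun x => ddθ j x * θ x) volume := fun j => integrable_L2_mul _ _
  have J6 : ∀ i, Integrable (fun x => w i x * wt i x) volume := fun i => integrable_L2_mul _ _
  have J7 : Integrable (fun x => θ x * θt x) volume := integrable_L2_mul _ _
  have J8 : ∀ j, Integrable (fun x => ddθ j x * θt x) volume := fun j => integrable_L2_mul _ _
  -- The differences split as u·∇u - v·∇v = u·∇w + w·∇v, ∇φΔφ - ∇ψΔψ = ∇φΔθ + ∇θΔψ and u·∇φ - v·∇ψ =
  -- u·∇θ + w·∇ψ = w·∇φ + v·∇θ. The last form is used against Δθ, where S Δθ (w·∇φ) cancels.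
  have hpt : ∀ᵐ x, ∑ i, w i x * wt i x + θ x * θt x - S * ∑ j, ddθ j x * θt x
      ≤ - ∑ i, q i x * w i x - ∑ i, (∑ j, u j x * dw i j x) * w i x
        - (∑ j, u j x * dθ j x) * θ x + ν * ∑ i, ∑ j, weakD j (weakD j (u i)) x * w i x
        + η * ∑ j, ddθ j x * θ x
        + K * (∑ i, w i x ^ 2 + θ x ^ 2 + S * ∑ j, dθ j x ^ 2) := by
    have cs : ∀ f g : L2, ∀ᵐ x, (f - g : L2) x = f x - g x := fun f g => Lp.coeFn_sub f g
    have ew := ae_all_iff.mpr fun i => cs (u i) (v i)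
    have ewt := ae_all_iff.mpr fun i => cs (ut i) (vt i)
    have edw := ae_all_iff.mpr fun i => ae_all_iff.mpr fun j => cs (weakD j (u i)) (weakD j (v i))
    have eq' := ae_all_iff.mpr fun i => cs (Q i) (Q' i)
    have edθ := ae_all_iff.mpr fun j => cs (weakD j φ) (weakD j ψ)
    have eddθ := ae_all_iff.mpr fun j => cs (weakD j (weakD j φ)) (weakD j (weakD j ψ))
    filter_upwards [ew, ewt, edw, eq', edθ, eddθ, cs φ ψ, cs φt ψt, ae_all_iff.mpr hQ,
      ae_all_iff.mpr hQ', hfφ, hfψ, ae_all_iff.mpr bv,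
      ae_all_iff.mpr fun i => ae_all_iff.mpr (bdv i), ae_all_iff.mpr bψ, bLψ]
      with x ew ewt edw eq' edθ eddθ eθ eθt mu mv fφ fψ bv bdv bψ bLψ
    have quad := quadratic_estimate (w := fun i => w i x) (v := fun i => v i x)
      (ψ' := fun i => weakD i ψ x) (θ' := fun i => dθ i x) (dv := fun i j => weakD j (v i) x)
      (θ := θ x) (Lθ := ∑ j, ddθ j x) hB hS hη bv bdv bψ bLψ
    refine le_trans (le_of_eq ?_) (add_le_add_right quad _)
    simp only [w, wt, dw, q, θ, θt, dθ, ddθ, ew, ewt, edw, eq', edθ, eddθ, eθ, eθt, mu, mv]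
    have e1 : φt x = η * ∑ j, weakD j (weakD j φ) x - ∑ j, u j x * weakD j φ x := by linarith
    have e2 : ψt x = η * ∑ j, weakD j (weakD j ψ) x - ∑ j, v j x * weakD j ψ x := by linarith
    rw [e1, e2]
    simp only [Fin.sum_univ_two]
    ring
  have Lint := ((integrable_finsetSum Finset.univ fun i _ => J6 i).add J7).sub
    ((integrable_finsetSum Finset.univ fun j _ => J8 j).const_mul S)
  have A1 := integrable_finsetSum Finset.univ fun i _ => J1 i
  have A2 := integrable_finsetSum Finset.univ fun i _ => Jt (dw i) (w i)
  have A3 := Jt dθ θ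
  have A4 := (integrable_finsetSum Finset.univ fun i _ =>
    integrable_finsetSum Finset.univ fun j _ => J4 i j).const_mul ν
  have A5 := (integrable_finsetSum Finset.univ fun j _ => J5 j).const_mul η
  have A6a := integrable_finsetSum Finset.univ fun i (_ : i ∈ Finset.univ) => integrable_sq_L2 (w i)
  have A6b := (integrable_finsetSum Finset.univ
    fun i (_ : i ∈ Finset.univ) => integrable_sq_L2 (dθ i)).const_mul S
  have A6 := ((A6a.add (integrable_sq_L2 θ)).add A6b).const_mul K
  have mono := integral_mono_ae Lint (((((A1.neg.sub A2).sub A3).add A4).add A5).add A6) hpt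
  rw [integral_add' ((((A1.neg.sub A2).sub A3).add A4).add A5) A6,
    integral_add' (((A1.neg.sub A2).sub A3).add A4) A5,
    integral_add' ((A1.neg.sub A2).sub A3) A4,
    integral_sub' (A1.neg.sub A2) A3, integral_sub' A1.neg A2, integral_neg',
    integral_sub' ((integrable_finsetSum Finset.univ fun i _ => J6 i).add J7)
      ((integrable_finsetSum Finset.univ fun j _ => J8 j).const_mul S),
    integral_add' (integrable_finsetSum Finset.univ fun i _ => J6 i) J7,
    integral_const_mul, integral_const_mul, integral_const_mul, integral_const_mul,
    integral_finsetSum _ fun i _ => J1 i, I1, integral_finsetSum _ fun i _ => Jt (dw i) (w i),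
    I3, integral_finsetSum _ fun i _ => J6 i, integral_finsetSum _ fun i _ => J8 i,
    integral_finsetSum _ fun i _ => J5 i,
    integral_finsetSum _ fun i _ => integrable_finsetSum Finset.univ fun j _ => J4 i j] at mono
  have e6 : ∫ x, ((fun x => ∑ i, w i x ^ 2) + (fun x => θ x ^ 2) + fun x => S * ∑ j, dθ j x ^ 2) x
      = ∑ i, ‖w i‖ ^ 2 + ‖θ‖ ^ 2 + S * ∑ j, ‖dθ j‖ ^ 2 := by
    rw [integral_add' (A6a.add (integrable_sq_L2 θ)) A6b,
      integral_add' A6a (integrable_sq_L2 θ), integral_const_mul,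
      integral_finsetSum _ fun i _ => integrable_sq_L2 (w i),
      integral_finsetSum _ fun i _ => integrable_sq_L2 (dθ i)]
    simp only [norm_sq_L2_eq]
  have e4 : ν * ∑ i, ∫ x, ∑ j, weakD j (weakD j (u i)) x * w i x
      ≤ ν / 4 * ∑ i, ∑ j, ‖weakD j (v i)‖ ^ 2 := by
    simp_rw [fun i => integral_finsetSum Finset.univ fun j _ => J4 i j]
    rw [Finset.mul_sum, Finset.mul_sum]
    exact Finset.sum_le_sum fun i _ => I4 i
  simp only [I2, Finset.sum_const_zero] at mono
  simp only [inner_L2_eq]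
  rw [e6] at mono
  refine mono.trans ?_
  change _ ≤ K * (∑ i, ‖w i‖ ^ 2 + ‖θ‖ ^ 2 + S * ∑ j, ‖dθ j‖ ^ 2) + _
  linarith

/-! ### Uniform bounds for the inviscid solution. -/

/-- All iterated derivatives of `f` of order at most `k`, in any order, have norm at most `M`. -/
def DerivBound (M : ℝ) : ℕ → L2 → Prop
  | 0, f => ‖f‖ ≤ M
  | k + 1, f => ‖f‖ ≤ M ∧ ∀ j, DerivBound M k (weakD j f)

lemma DerivBound.norm_le {M : ℝ} {k : ℕ} {f : L2} (h : DerivBound M k f) : ‖f‖ ≤ M := by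
  cases k with
  | zero => exact h
  | succ k => exact h.1

lemma iterate_weakD_comm : ∀ (b : ℕ) {f : L2}, MemH (b + 1) f →
    (weakD 1)^[b] (weakD 0 f) = weakD 0 ((weakD 1)^[b] f)
  | 0, _, _ => rfl
  | b + 1, f, h => by
    rw [Function.iterate_succ_apply, Function.iterate_succ_apply,
      weakD_comm (h.mono (by omega)) 1 0, iterate_weakD_comm b (h.weakD 1)]

/-- The hypothesis covers only derivatives in the order ∂₁ᵃ∂₂ᵇ; commutation brings any other order
to this one. -/
lemma derivBound_of_weakDD {M : ℝ} : ∀ {k : ℕ} {f : L2}, MemH k f →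
    (∀ a b : ℕ, a + b ≤ k → ‖weakDD a b f‖ ≤ M) → DerivBound M k f
  | 0, _, _, hM => hM 0 0 le_rfl
  | k + 1, f, h, hM => by
    refine ⟨hM 0 0 (Nat.zero_le _), fun j => derivBound_of_weakDD (h.weakD j) fun a b hab => ?_⟩
    fin_cases j
    · have e : weakDD a b (weakD 0 f) = weakDD (a + 1) b f := by
        unfold weakDD
        rw [iterate_weakD_comm b (h.mono (by omega)), ← Function.iterate_succ_apply]
      exact e ▸ hM (a + 1) b (by omega)
    · exact hM a (b + 1) (by omega)

lemma MemLpH.exists_derivBound {k : ℕ} {T : ℝ} {f : ℝ → L2} (h : MemLpH ∞ k T f) :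
    ∃ M : ℝ, 0 ≤ M ∧ ∀ᵐ t ∂volume.restrict (Ioo 0 T), MemH k (f t) ∧ DerivBound M k (f t) := by
  have : ∀ a b : ℕ, ∃ M : ℝ, a + b ≤ k →
      ∀ᵐ t ∂volume.restrict (Ioo 0 T), ‖weakDD a b (f t)‖ ≤ M := fun a b => by
    by_cases hab : a + b ≤ k
    · obtain ⟨M, hM⟩ := exists_ae_norm_le_of_memLp_top (h.2 a b hab)
      exact ⟨M, fun _ => hM⟩
    · exact ⟨0, fun h => absurd h hab⟩
  choose M hM using this
  refine ⟨∑ a ∈ Finset.range (k + 1), ∑ b ∈ Finset.range (k + 1), |M a b|,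
    Finset.sum_nonneg fun _ _ => Finset.sum_nonneg fun _ _ => abs_nonneg _, ?_⟩
  have hall : ∀ᵐ t ∂volume.restrict (Ioo 0 T), ∀ a b : ℕ, a + b ≤ k → ‖weakDD a b (f t)‖ ≤ M a b :=
    ae_all_iff.mpr fun a => ae_all_iff.mpr fun b => by
      by_cases hab : a + b ≤ k
      · filter_upwards [hM a b hab] with t ht _ using ht
      · exact Eventually.of_forall fun t h => absurd h hab
  filter_upwards [h.1, hall] with t h1 h2
  refine ⟨h1, derivBound_of_weakDD h1 fun a b hab => (h2 a b hab).trans ?_⟩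
  have ha : a ∈ Finset.range (k + 1) := Finset.mem_range.mpr (by omega)
  have hb : b ∈ Finset.range (k + 1) := Finset.mem_range.mpr (by omega)
  calc M a b ≤ |M a b| := le_abs_self _
    _ ≤ ∑ b ∈ Finset.range (k + 1), |M a b| :=
      Finset.single_le_sum (f := fun b => |M a b|) (fun _ _ => abs_nonneg _) hb
    _ ≤ _ := Finset.single_le_sum (f := fun a => ∑ b ∈ Finset.range (k + 1), |M a b|)
      (fun _ _ => Finset.sum_nonneg fun _ _ => abs_nonneg _) ha

lemma MemLpH.mono {k l : ℕ} (hkl : k ≤ l) {p : ℝ≥0∞} {T : ℝ} {f : ℝ → L2} (h : MemLpH p l T f) :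
    MemLpH p k T f :=
  ⟨h.1.mono fun _ ht => ht.mono hkl, fun a b hab => h.2 a b (hab.trans hkl)⟩

/-- Uniform bounds for a smooth solution of the inviscid system. -/
lemma exists_uniform_bounds {T : ℝ} {v : ℝ → Fin 2 → L2} {ψ : ℝ → L2}
    (hv : ∀ i, MemLpH ∞ 3 T (fun t => v t i)) (hψ : MemLpH ∞ 4 T ψ) :
    ∃ B D : ℝ, 0 ≤ B ∧ 0 ≤ D ∧ ∀ᵐ t ∂volume.restrict (Ioo 0 T),
      (∀ i, MemH 3 (v t i)) ∧ MemH 4 (ψ t) ∧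
      (∀ i, ∀ᵐ x, |v t i x| ≤ B) ∧ (∀ i j, ∀ᵐ x, |weakD j (v t i) x| ≤ B) ∧
      (∀ i, ∀ᵐ x, |weakD i (ψ t) x| ≤ B) ∧ (∀ᵐ x, |∑ j, weakD j (weakD j (ψ t)) x| ≤ B) ∧
      ∑ i, ∑ j, ‖weakD j (v t i)‖ ^ 2 ≤ D := by
  obtain ⟨C, hC0, hC⟩ := exists_sobolev_const
  obtain ⟨M0, hM0, h0⟩ := (hv 0).exists_derivBound
  obtain ⟨M1, hM1, h1⟩ := (hv 1).exists_derivBound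
  obtain ⟨M2, hM2, h2⟩ := hψ.exists_derivBound
  let N : ℝ := M0 + M1 + M2
  have hN : 0 ≤ N := by positivity
  have sup : ∀ {M : ℝ} {f : L2}, M ≤ N → MemH 2 f → DerivBound M 2 f →
      ∀ᵐ x, |f x| ≤ 3 * C * N := by
    intro M f hMN hf hb
    filter_upwards [hC f (fun j => weakD j f) (fun j => weakD j (weakD j f))
      (fun j => hf.isWeakPartial j) (fun j => (hf.weakD j).isWeakPartial j)] with x hx
    refine hx.trans ?_
    rw [Fin.sum_univ_two]
    have a := hb.norm_le
    have b := ((hb.2 0).2 0).norm_le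
    have c := ((hb.2 1).2 1).norm_le
    calc _ ≤ C * (3 * N) := mul_le_mul_of_nonneg_left (by linarith) hC0
      _ = _ := by ring
  have lower : ∀ {M : ℝ} {f : L2}, DerivBound M 3 f → DerivBound M 2 f := fun h =>
    ⟨h.1, fun j => ⟨(h.2 j).1, fun l => ((h.2 j).2 l).norm_le⟩⟩
  have hCN : 0 ≤ C * N := mul_nonneg hC0 hN
  have hvb : ∀ {M : ℝ} {f : L2}, M ≤ N → MemH 3 f → DerivBound M 3 f →
      (∀ᵐ x, |f x| ≤ 6 * C * N) ∧ ∀ j, (∀ᵐ x, |weakD j f x| ≤ 6 * C * N) ∧ ‖weakD j f‖ ≤ N := by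
    intro M f hMN hf hb
    refine ⟨?_, fun j => ⟨?_, ((hb.2 j).norm_le).trans hMN⟩⟩
    · filter_upwards [sup hMN hf.of_succ (lower hb)] with x hx using hx.trans (by linarith)
    · filter_upwards [sup hMN (hf.weakD j) (hb.2 j)] with x hx using hx.trans (by linarith)
  -- The embedding gives 3CN, from ‖f‖ and two second derivatives; the factor 2 covers the two terms
  -- of Δψ. The four entries of ∇v give 4N².
  refine ⟨6 * C * N, 4 * N ^ 2, by linarith, by positivity, ?_⟩
  filter_upwards [h0, h1, h2] with t ⟨m0, b0⟩ ⟨m1, b1⟩ ⟨m2, b2⟩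
  have k0 := hvb (by simp only [N]; linarith) m0 b0
  have k1 := hvb (by simp only [N]; linarith) m1 b1
  have hM2N : M2 ≤ N := by simp only [N]; linarith
  have mv : ∀ i, MemH 3 (v t i) := Fin.forall_fin_two.mpr ⟨m0, m1⟩
  have kv : ∀ i, (∀ᵐ x, |v t i x| ≤ 6 * C * N) ∧
      ∀ j, (∀ᵐ x, |weakD j (v t i) x| ≤ 6 * C * N) ∧ ‖weakD j (v t i)‖ ≤ N :=
    Fin.forall_fin_two.mpr ⟨k0, k1⟩
  refine ⟨mv, m2, fun i => (kv i).1, fun i j => ((kv i).2 j).1, fun i => ?_, ?_, ?_⟩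
  · filter_upwards [sup hM2N (m2.weakD i).of_succ (lower (b2.2 i))] with x hx
      using hx.trans (by linarith)
  · have s : ∀ j, ∀ᵐ x, |weakD j (weakD j (ψ t)) x| ≤ 3 * C * N := fun j =>
      sup hM2N ((m2.weakD j).weakD j) ((b2.2 j).2 j)
    filter_upwards [s 0, s 1] with x a b
    rw [Fin.sum_univ_two]
    exact (abs_add_le _ _).trans (by linarith)
  · have hs : ∀ i j, ‖weakD j (v t i)‖ ^ 2 ≤ N ^ 2 := fun i j =>
      pow_le_pow_left₀ (norm_nonneg _) ((kv i).2 j).2 2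
    simp only [Fin.sum_univ_two]
    linarith [hs 0 0, hs 0 1, hs 1 0, hs 1 1]

/-! ### Gronwall's inequality and the stability estimate. -/

/-- Linearity in the source term turns the factor ν of the source into the rate 1/Re. -/
lemma gronwallBound_zero_eq_mul (k c x : ℝ) : gronwallBound 0 k c x = c * gronwallBound 0 k 1 x := by
  unfold gronwallBound
  split_ifs
  · ring
  · ring

/-- Gronwall's inequality for a nonnegative function given by an integral. -/
lemma gronwall_of_integral {T k c : ℝ} (hk : 0 ≤ k) (hc : 0 ≤ c) {E g : ℝ → ℝ}
    (hg : IntervalIntegrable g volume 0 T) (hE : ∀ t ∈ Icc 0 T, E t = ∫ s in 0..t, g s)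
    (hE0 : ∀ t ∈ Icc 0 T, 0 ≤ E t)
    (hle : ∀ᵐ s ∂volume.restrict (Ioo 0 T), g s ≤ k * E s + c) :
    ∀ t ∈ Icc 0 T, E t ≤ c * gronwallBound 0 k 1 T := by
  intro t ht
  have hT : 0 ≤ T := ht.1.trans ht.2
  have hEc : ContinuousOn E (Icc 0 T) := by
    have := intervalIntegral.continuousOn_primitive_interval' hg left_mem_uIcc
    rw [uIcc_of_le hT] at this
    exact this.congr hE
  -- E need not be differentiable everywhere, whereas the primitive F of kE' + c is C¹, dominates E,
  -- and satisfies F' ≤ kF + c on [0, T).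
  let E' : ℝ → ℝ := IccExtend hT ((Icc 0 T).domRestrict E)
  have hE'c : Continuous E' := (continuousOn_iff_continuous_domRestrict.mp hEc).Icc_extend'
  have hE' : ∀ s ∈ Icc 0 T, E' s = E s := fun s hs => IccExtend_of_mem hT _ hs
  let F : ℝ → ℝ := fun t => ∫ s in 0..t, k * E' s + c
  have hcont : Continuous fun s => k * E' s + c := by fun_prop
  have hF : ∀ x, HasDerivAt F (k * E' x + c) x := fun x =>
    intervalIntegral.integral_hasDerivAt_right (hcont.intervalIntegrable _ _)
      (hcont.stronglyMeasurableAtFilter _ _) hcont.continuousAt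
  have hEF : ∀ s ∈ Icc 0 T, E s ≤ F s := fun s hs => by
    rw [hE s hs]
    refine intervalIntegral.integral_mono_ae_restrict hs.1
      (hg.mono_set (by rw [uIcc_of_le hs.1, uIcc_of_le hT]; exact Icc_subset_Icc le_rfl hs.2))
      (hcont.intervalIntegrable _ _) ?_
    rw [← Measure.restrict_congr_set Ioo_ae_eq_Icc]
    have hsub : Ioo 0 s ⊆ Ioo 0 T := Ioo_subset_Ioo le_rfl hs.2
    filter_upwards [ae_restrict_of_ae_restrict_of_subset hsub hle,
      ae_restrict_mem measurableSet_Ioo] with r hr hmem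
    rwa [hE' r (Ioo_subset_Icc_self (hsub hmem))]
  have key := norm_le_gronwallBound_of_norm_deriv_right_le (f := F) (f' := fun x => k * E' x + c)
    (δ := 0) (K := k) (ε := c) (a := 0) (b := T)
    (fun x _ => (hF x).continuousAt.continuousWithinAt) (fun x _ => (hF x).hasDerivWithinAt)
    (by simp [F]) (fun x hx => by
      have hx' := Ico_subset_Icc_self hx
      have h1 := hEF x hx'
      have h2 := hE0 x hx'
      rw [hE' x hx', Real.norm_of_nonneg (by positivity), Real.norm_of_nonneg (h2.trans h1)]
      gcongr) t ht
  rw [sub_zero] at key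
  calc E t ≤ F t := hEF t ht
    _ ≤ ‖F t‖ := Real.le_norm_self _
    _ ≤ gronwallBound 0 k c t := key
    _ ≤ gronwallBound 0 k c T := gronwallBound_mono le_rfl hc hk ht.2
    _ = _ := gronwallBound_zero_eq_mul k c T

lemma IsTimeDeriv.sub {T : ℝ} (hT : 0 ≤ T) {f f' g g' : ℝ → L2} (hf : IsTimeDeriv T f f')
    (hg : IsTimeDeriv T g g') :
    IsTimeDeriv T (fun t => f t - g t) (fun t => f' t - g' t) := by
  refine ⟨hf.1.sub hg.1, fun t ht => ?_⟩
  have hsub : uIcc 0 t ⊆ uIcc 0 T := by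
    rw [uIcc_of_le ht.1, uIcc_of_le hT]; exact Icc_subset_Icc le_rfl ht.2
  simp only
  rw [intervalIntegral.integral_sub (hf.1.mono_set hsub) (hg.1.mono_set hsub), hf.2 t ht, hg.2 t ht]
  abel

lemma IsTimeDeriv.norm_sq_eq {T : ℝ} (hT : 0 ≤ T) {f f' : ℝ → L2} (hf : IsTimeDeriv T f f')
    (h0 : f 0 = 0) :
    IntervalIntegrable (fun s => inner ℝ (f s) (f' s)) volume 0 T ∧
      ∀ t ∈ Icc 0 T, ‖f t‖ ^ 2 = ∫ s in 0..t, 2 * inner ℝ (f s) (f' s) := by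
  obtain ⟨hi, he⟩ := hf
  simp only [h0, zero_add] at he
  constructor
  · refine (intervalIntegrable_inner_primitive hi).congr fun s hs => ?_
    have hs' := uIoc_subset_uIcc hs
    rw [uIcc_of_le hT] at hs'
    rw [he s hs']
  · intro t ht
    have hsub : uIcc 0 t ⊆ uIcc 0 T := by
      rw [uIcc_of_le ht.1, uIcc_of_le hT]; exact Icc_subset_Icc le_rfl ht.2
    rw [he t ht, norm_sq_primitive (hi.mono_set hsub)]
    refine intervalIntegral.integral_congr fun s hs => ?_
    have hs' := hsub hs
    rw [uIcc_of_le hT] at hs'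
    rw [he s hs']

lemma hNormSq_one (f : L2) : hNormSq 1 f = ‖f‖ ^ 2 + ∑ j, ‖weakD j f‖ ^ 2 := by
  simp only [hNormSq, weakDD, Finset.sum_range_succ, Finset.sum_range_zero, Fin.sum_univ_two,
    Nat.reduceAdd, Nat.reduceSub, Function.iterate_zero, Function.iterate_one, id_eq]
  ring

lemma energyError_nonneg {lam : ℝ} (h : 0 ≤ lam) (u v : Fin 2 → L2) (φ ψ : L2) :
    0 ≤ energyError lam u v φ ψ := by
  unfold energyError
  rw [hNormSq_one]
  positivity

/-- The weight S is imposed by the cancellation and `lam` is arbitrary; the factor dominates 1,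
`lam` and `lam / S`. -/
lemma energyError_le {lam S : ℝ} (hlam : 0 < lam) (hS : 0 < S) (u v : Fin 2 → L2) (φ ψ : L2) :
    energyError lam u v φ ψ ≤ (1 + lam + lam / S) *
      (∑ i, ‖u i - v i‖ ^ 2 + ‖φ - ψ‖ ^ 2 + S * ∑ j, ‖weakD j (φ - ψ)‖ ^ 2) := by
  unfold energyError
  rw [hNormSq_one]
  have a : 0 ≤ ∑ i, ‖u i - v i‖ ^ 2 := by positivity
  have b : 0 ≤ ∑ j, ‖weakD j (φ - ψ)‖ ^ 2 := by positivity
  have c : 0 ≤ ‖φ - ψ‖ ^ 2 := by positivity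
  generalize ∑ i, ‖u i - v i‖ ^ 2 = A at *
  generalize ∑ j, ‖weakD j (φ - ψ)‖ ^ 2 = D at *
  generalize ‖φ - ψ‖ ^ 2 = E at *
  have e : (1 + lam + lam / S) * (A + E + S * D)
      = (A + lam * (E + D)) + (lam * A + lam / S * A + E + lam / S * E + S * D + lam * S * D) := by
    field_simp; ring
  rw [e]
  have : 0 ≤ lam * A + lam / S * A + E + lam / S * E + S * D + lam * S * D := by positivity
  linarith

/-- The stability estimate for the difference of a viscous and an inviscid solution on `[0, T]`
with the same initial data, the inviscid one being uniformly bounded with its derivatives. -/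
lemma stability_estimate {ν η S T B D : ℝ} (hν : 0 ≤ ν) (hη : 0 < η) (hS : 0 < S) (hT : 0 ≤ T)
    (hB : 0 ≤ B) (hD : 0 ≤ D) {u₀ : Fin 2 → L2} {φ₀ : L2} {u v : ℝ → Fin 2 → L2} {φ ψ : ℝ → L2}
    (hu : SolvesMHD ν η S T u₀ φ₀ u φ) (hv : SolvesMHD 0 η S T u₀ φ₀ v ψ)
    (hu2 : ∀ i, ∀ᵐ t ∂volume.restrict (Ioo 0 T), MemH 2 (u t i))
    (hφ2 : MemLpH ∞ 2 T φ) (hφ3 : ∀ᵐ t ∂volume.restrict (Ioo 0 T), MemH 3 (φ t))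
    (hψ2 : MemLpH ∞ 2 T ψ)
    (hb : ∀ᵐ t ∂volume.restrict (Ioo 0 T),
      (∀ i, MemH 3 (v t i)) ∧ MemH 4 (ψ t) ∧
      (∀ i, ∀ᵐ x, |v t i x| ≤ B) ∧ (∀ i j, ∀ᵐ x, |weakD j (v t i) x| ≤ B) ∧
      (∀ i, ∀ᵐ x, |weakD i (ψ t) x| ≤ B) ∧ (∀ᵐ x, |∑ j, weakD j (weakD j (ψ t)) x| ≤ B) ∧
      ∑ i, ∑ j, ‖weakD j (v t i)‖ ^ 2 ≤ D) :
    ∀ t ∈ Icc 0 T, MemH 1 (φ t - ψ t) ∧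
      ∑ i, ‖u t i - v t i‖ ^ 2 + ‖φ t - ψ t‖ ^ 2 + S * ∑ j, ‖weakD j (φ t - ψ t)‖ ^ 2
        ≤ ν / 2 * D * gronwallBound 0 (2 * (3 * B + S * B + B ^ 2 / (2 * η))) 1 T := by
  set K := 3 * B + S * B + B ^ 2 / (2 * η)
  have hK : 0 ≤ K := by positivity
  obtain ⟨hu0, hφ0, hdu, ut, φt, htu, htφ, hequ⟩ := hu
  obtain ⟨hv0, hψ0, hdv, vt, ψt, htv, htψ, heqv⟩ := hv
  let L : Fin 2 → ℝ → L2 := fun j t => weakD j (weakD j (φ t)) - weakD j (weakD j (ψ t))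
  have hw := fun i => ((htu i).sub hT (htv i)).norm_sq_eq hT (by simp [hu0, hv0])
  have htθ := htφ.sub hT htψ
  have hθ0 : φ 0 - ψ 0 = 0 := by rw [hφ0, hψ0, sub_self]
  have hθ := htθ.norm_sq_eq hT hθ0
  have hLm : ∀ j, MemLp (L j) ∞ (volume.restrict (Ioo 0 T)) := by
    refine Fin.forall_fin_two.mpr ⟨?_, ?_⟩
    · exact (hφ2.2 2 0 le_rfl).sub (hψ2.2 2 0 le_rfl)
    · exact (hφ2.2 0 2 le_rfl).sub (hψ2.2 0 2 le_rfl)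
  have hLw : ∀ j, ∀ᵐ s ∂volume.restrict (Ioo 0 T), ∃ g : L2,
      IsWeakPartial j (φ s - ψ s : L2) g ∧ IsWeakPartial j g (L j s) := fun j => by
    filter_upwards [hφ2.1, hψ2.1] with s h1 h2
    exact ⟨_, (h1.isWeakPartial j).sub_L2 (h2.isWeakPartial j),
      ((h1.weakD j).isWeakPartial j).sub_L2 ((h2.weakD j).isWeakPartial j)⟩
  have hd := fun j => norm_sq_weakPartial_curve hT htθ hθ0 (hLw j) (hLm j)
  let E : ℝ → ℝ := fun t => ∑ i, ‖u t i - v t i‖ ^ 2 + ‖φ t - ψ t‖ ^ 2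
    + S * ∑ j, ‖weakD j (φ t - ψ t)‖ ^ 2
  let g : ℝ → ℝ := fun s => ∑ i, 2 * inner ℝ (u s i - v s i) (ut s i - vt s i)
    + 2 * inner ℝ (φ s - ψ s) (φt s - ψt s)
    + S * ∑ j, -2 * inner ℝ (L j s) (φt s - ψt s)
  have i1 := fun i => (hw i).1.const_mul 2
  have i2 := hθ.1.const_mul 2
  have i3 := fun j => (hd j).1.const_mul (-2)
  have i1s : IntervalIntegrable (fun s => ∑ i, 2 * inner ℝ (u s i - v s i) (ut s i - vt s i))
      volume 0 T := by
    simp only [Fin.sum_univ_two]; exact (i1 0).add (i1 1)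
  have i3s : IntervalIntegrable (fun s => ∑ j, -2 * inner ℝ (L j s) (φt s - ψt s))
      volume 0 T := by
    simp only [Fin.sum_univ_two]; exact (i3 0).add (i3 1)
  have hg : IntervalIntegrable g volume 0 T := (i1s.add i2).add (i3s.const_mul S)
  have hE : ∀ t ∈ Icc 0 T, E t = ∫ s in 0..t, g s := fun t ht => by
    have hsub : uIcc 0 t ⊆ uIcc 0 T := by
      rw [uIcc_of_le ht.1, uIcc_of_le hT]; exact Icc_subset_Icc le_rfl ht.2
    -- The derivative exists at this very t, so `weakD` does not take its default value 0.
    have h3 : ∀ j, ‖weakD j (φ t - ψ t)‖ ^ 2 = ∫ s in 0..t, -2 * inner ℝ (L j s) (φt s - ψt s) :=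
      fun j => by
        obtain ⟨γ, hγ, hn⟩ := (hd j).2 t ht
        rw [weakD_eq hγ, hn]
    simp only [E, g]
    rw [intervalIntegral.integral_add ((i1s.add i2).mono_set hsub)
        ((i3s.const_mul S).mono_set hsub),
      intervalIntegral.integral_add (i1s.mono_set hsub) (i2.mono_set hsub),
      intervalIntegral.integral_const_mul S,
      intervalIntegral.integral_finsetSum fun i _ => (i1 i).mono_set hsub,
      intervalIntegral.integral_finsetSum fun j _ => (i3 j).mono_set hsub, hθ.2 t ht]
    simp only [fun i => (hw i).2 t ht, h3]
  -- Twice the fixed-time inequality, hence 2K and 2 · ν/4 = ν/2.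
  have hle : ∀ᵐ s ∂volume.restrict (Ioo 0 T), g s ≤ 2 * K * E s + ν / 2 * D := by
    filter_upwards [hequ, heqv, ae_all_iff.mpr hu2, hφ3, hb, ae_restrict_mem measurableSet_Ioo]
      with s h1 h2 h3 h4 ⟨b1, b2, b3, b4, b5, b6, b7⟩ hs
    have hs' := Ioo_subset_Icc_self hs
    have key := energy_inequality hν hη hS hB h3 (fun i => (b1 i).of_succ) h4 b2.of_succ
      (hdu s hs') (hdv s hs') h1.1 h2.1 h1.2 h2.2 b3 b4 b5 b6
    have e : ∀ j, weakD j (φ s - ψ s) = weakD j (φ s) - weakD j (ψ s) := fun j =>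
      weakD_eq ((h4.isWeakPartial j).sub_L2 (b2.isWeakPartial j))
    have b7' := mul_le_mul_of_nonneg_left b7 (by positivity : 0 ≤ ν / 4)
    simp only [g, E, L, e]
    simp only [← Finset.mul_sum]
    linarith
  intro t ht
  refine ⟨fun j => ?_, gronwall_of_integral (by positivity) (by positivity) hg hE
    (fun s _ => by positivity) hle t ht⟩
  obtain ⟨γ, hγ, -⟩ := (hd j).2 t ht
  exact ⟨γ, hγ, trivial⟩

end MHD

end

theorem mainTheorem5
    (Rm S lam : ℝ) (hRm : 0 < Rm) (hS : 0 < S) (hlam : 0 < lam)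
    (s : ℕ) (hs : 3 ≤ s) (Tstar : ℝ) (hT : 0 < Tstar)
    (u₀ : Fin 2 → MHD.L2) (φ₀ : MHD.L2)
    (v : ℝ → Fin 2 → MHD.L2) (ψ : ℝ → MHD.L2)
    (hv : MHD.IsLocalSmoothSolution s Rm S Tstar u₀ φ₀ v ψ) :
    (∃ C : ℝ, ∀ Re : ℝ, 0 < Re →
      ∀ (u : ℝ → Fin 2 → MHD.L2) (φ : ℝ → MHD.L2),
        MHD.IsGlobalStrongSolution Re Rm S u₀ φ₀ u φ →
        ∀ t ∈ Icc 0 Tstar, MHD.MemH 1 (φ t - ψ t) ∧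
          MHD.energyError lam (u t) (v t) (φ t) (ψ t) ≤ C * Re⁻¹) ∧
    (∀ (u : ℝ → ℝ → Fin 2 → MHD.L2) (φ : ℝ → ℝ → MHD.L2),
      (∀ᶠ Re in atTop, MHD.IsGlobalStrongSolution Re Rm S u₀ φ₀ (u Re) (φ Re)) →
      ∀ t ∈ Icc 0 Tstar,
        Tendsto (fun Re => MHD.energyError lam (u Re t) (v t) (φ Re t) (ψ t)) atTop (𝓝 0)) := by
  have main : ∃ C : ℝ, ∀ Re : ℝ, 0 < Re →
      ∀ (u : ℝ → Fin 2 → MHD.L2) (φ : ℝ → MHD.L2),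
        MHD.IsGlobalStrongSolution Re Rm S u₀ φ₀ u φ →
        ∀ t ∈ Icc 0 Tstar, MHD.MemH 1 (φ t - ψ t) ∧
          MHD.energyError lam (u t) (v t) (φ t) (ψ t) ≤ C * Re⁻¹ := by
    obtain ⟨hsolv, hvs, hψs⟩ := hv
    have hψ4 : MHD.MemLpH ∞ 4 Tstar ψ := hψs.mono (by omega)
    obtain ⟨B, D, hB, hD, hb⟩ := MHD.exists_uniform_bounds (fun i => (hvs i).mono hs) hψ4
    set Γ := gronwallBound 0 (2 * (3 * B + S * B + B ^ 2 / (2 * (1 / Rm)))) 1 Tstar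
    -- B, D and Γ come from the inviscid solution alone, so the constant is fixed before `Re`, u and
    -- φ.
    refine ⟨(1 + lam + lam / S) * (1 / 2 * D * Γ), fun Re hRe u φ hu t ht => ?_⟩
    obtain ⟨hsolu, hu', hφ2, hφ3⟩ := hu Tstar hT
    obtain ⟨h1, h2⟩ := MHD.stability_estimate (by positivity) (by positivity) hS hT.le hB hD hsolu
      hsolv (fun i => (hu' i).2.1) hφ2 hφ3.1 (hψ4.mono (by norm_num)) hb t ht
    refine ⟨h1, (MHD.energyError_le hlam hS _ _ _ _).trans ?_⟩
    calc _ ≤ (1 + lam + lam / S) * (1 / Re / 2 * D * Γ) :=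
          mul_le_mul_of_nonneg_left h2 (by positivity)
      _ = _ := by ring
  refine ⟨main, fun u φ hu t ht => ?_⟩
  obtain ⟨C, hC⟩ := main
  have hlim : Tendsto (fun Re : ℝ => C * Re⁻¹) atTop (𝓝 0) := by
    simpa using tendsto_inv_atTop_zero.const_mul C
  refine squeeze_zero' (Eventually.of_forall fun Re => MHD.energyError_nonneg hlam.le _ _ _ _) ?_
    hlim
  filter_upwards [hu, eventually_gt_atTop 0] with Re h1 h2
  exact (hC Re h2 _ _ h1 t ht).2
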